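/- Let $r>0$, $\gamma>1/2$, and let $\ell$ be slowly varying at infinity, i.e. positive and measurable on some half-line $[A,\infty)$ with $\ell(at)/\ell(t)\to1$ as $t\to\infty$ for every $a>0$. Let $\lambda_n=\ell(n)n^{-\gamma}$, $n\ge1$, and assume that $(\lambda_n)_{n\ge1}$ is a non-increasing sequence of positive numbers. Let $\eta_1,\eta_2,\dots$ be i.i.d. gamma random variables with density $\frac{r^r}{\Gamma(r)}x^{r-1}e^{-rx}$, $x>0$. For $M\ge1$ let $$Y_M=\sum_{n=M}^\infty\lambda_n(\eta_n-1),\qquad \sigma_M^2=\operatorname{Var}Y_M,\qquad \widetilde Y_M=\sigma_M^{-1}Y_M,$$ and let $\kappa_{m,M}$ be the $m$-th cumulant of $\widetilde Y_M$, i.e. the $m$-th derivative at $t=0$ of $\log\mathbb E\,e^{t\widetilde Y_M}$. Then, for every $M\ge1$, the series defining $Y_M$ converges almost surely, $$\sigma_M^2=\frac1r\sum_{n=M}^\infty\lambda_n^2,\qquad \kappa_{m,M}=\frac{(m-1)!}{r^{m-1}\sigma_M^m}\sum_{n=M}^\infty\lambda_n^m\quad(m\ge2).$$ Moreover, for each $N\ge2$,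 as $M\to\infty$, $$\mathrm P[\widetilde Y_M\le x]=\Phi(x)-\phi(x)\sum_{(k_3,\dots,k_N)\in\eta(N)}\left[\prod_{m=3}^N\frac1{k_m!}\left(\frac{\kappa_{m,M}}{m!}\right)^{k_m}\right]H_{\zeta(k_3,\dots,k_N)}(x)+O\left(M^{-(N-1)/2}\right)$$ uniformly in $x\in\mathbb R$. Here $\Phi$ and $\phi$ are the standard normal distribution function and density; $H_k(x)=(-1)^ke^{x^2/2}\frac{d^k}{dx^k}e^{-x^2/2}$ are the Hermite polynomials; $\eta(N)$ is the set of all tuples of non-negative integers $(k_3,\dots,k_N)$ with $1\le k_3+2k_4+\dots+(N-2)k_N\le N-2$ (empty for $N=2$, so that the sum is then $0$); and $\zeta(k_3,\dots,k_N)=3k_3+4k_4+\dots+Nk_N-1$. -/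

import Mathlib

open MeasureTheory ProbabilityTheory Filter Topology

namespace GammaTail

/-- `ℓ` is slowly varying at infinity: it is positive and measurable on some half-line `[A, ∞)`,
and `ℓ (a t) / ℓ t → 1` as `t → ∞`, for every `a > 0`. -/
def SlowlyVarying (ℓ : ℝ → ℝ) : Prop :=
  (∃ A : ℝ, 0 < A ∧ (∀ t, A ≤ t → 0 < ℓ t) ∧ Measurable ((Set.Ici A).domRestrict ℓ)) ∧
    ∀ a : ℝ, 0 < a → Tendsto (fun t : ℝ => ℓ (a * t) / ℓ t) atTop (𝓝 1)

section RandomVariables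

variable {Ω : Type*} [MeasurableSpace Ω]

/-- The partial sum `∑_{n = M}^{K - 1} lam n (η n - 1)`. -/
noncomputable def partialTail (lam : ℕ → ℝ) (η : ℕ → Ω → ℝ) (M K : ℕ) (ω : Ω) : ℝ :=
  ∑ n ∈ Finset.Ico M K, lam n * (η n ω - 1)

/-- The tail `Y_M = ∑_{n = M}^∞ lam n (η n - 1)`, the pointwise limit of the partial sums. The
series need not converge absolutely, so this is not a `tsum`. -/
noncomputable def tail (lam : ℕ → ℝ) (η : ℕ → Ω → ℝ) (M : ℕ) (ω : Ω) : ℝ :=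
  limUnder atTop (fun K : ℕ => partialTail lam η M K ω)

/-- The standard deviation `σ_M` of `Y_M`. -/
noncomputable def tailStd (P : Measure Ω) (lam : ℕ → ℝ) (η : ℕ → Ω → ℝ) (M : ℕ) : ℝ :=
  Real.sqrt (variance (tail lam η M) P)

/-- The normalized tail `σ_M⁻¹ Y_M`. -/
noncomputable def normTail (P : Measure Ω) (lam : ℕ → ℝ) (η : ℕ → Ω → ℝ) (M : ℕ) (ω : Ω) : ℝ :=
  (tailStd P lam η M)⁻¹ * tail lam η M ω

/-- The `k`-th cumulant of `X`: the `k`-th derivative at `0` of `t ↦ log E[exp (t X)]`. -/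
noncomputable def cumulant (P : Measure Ω) (X : Ω → ℝ) (k : ℕ) : ℝ :=
  iteratedDeriv k (cgf X P) 0

end RandomVariables

/-- The weighted sum `k_3 + 2 k_4 + ⋯ + (N - 2) k_N`. -/
def weight (N : ℕ) (k : Finset.Icc 3 N → ℕ) : ℕ :=
  ∑ m : Finset.Icc 3 N, ((m : ℕ) - 2) * k m

/-- The set of all `(k_3, …, k_N)` with `1 ≤ k_3 + 2 k_4 + ⋯ + (N - 2) k_N ≤ N - 2`. These
inequalities force `k_m ≤ N - 2`, see `mem_indexSet`. -/
def indexSet (N : ℕ) : Finset (Finset.Icc 3 N → ℕ) :=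
  (Fintype.piFinset fun _ => Finset.range (N - 1)).filter
    fun k => 1 ≤ weight N k ∧ weight N k ≤ N - 2

theorem mem_indexSet (N : ℕ) (k : Finset.Icc 3 N → ℕ) :
    k ∈ indexSet N ↔ 1 ≤ weight N k ∧ weight N k ≤ N - 2 := by
  unfold indexSet
  rw [Finset.mem_filter, and_iff_right_iff_imp]
  rintro ⟨-, h⟩
  rw [Fintype.mem_piFinset]
  intro m
  have h3 : 3 ≤ (m : ℕ) ∧ (m : ℕ) ≤ N := Finset.mem_Icc.mp m.2
  have h1 : ((m : ℕ) - 2) * k m ≤ weight N k :=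
    Finset.single_le_sum (f := fun m : Finset.Icc 3 N => ((m : ℕ) - 2) * k m)
      (fun _ _ => Nat.zero_le _) (Finset.mem_univ m)
  have h2 : 1 * k m ≤ ((m : ℕ) - 2) * k m := Nat.mul_le_mul_right _ (by omega)
  rw [Finset.mem_range]
  omega

/-- `ζ(k_3, …, k_N) = 3 k_3 + 4 k_4 + ⋯ + N k_N - 1`. -/
def zeta (N : ℕ) (k : Finset.Icc 3 N → ℕ) : ℕ :=
  (∑ m : Finset.Icc 3 N, (m : ℕ) * k m) - 1

/-- The Edgeworth approximation of order `N` with cumulants `κ`, where `Polynomial.hermite` is the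
probabilists' Hermite polynomial. -/
noncomputable def edgeworth (N : ℕ) (κ : ℕ → ℝ) (x : ℝ) : ℝ :=
  cdf (gaussianReal 0 1) x - gaussianPDFReal 0 1 x *
    ∑ k ∈ indexSet N,
      (∏ m : Finset.Icc 3 N,
        1 / ((k m).factorial : ℝ) * (κ m / ((m : ℕ).factorial : ℝ)) ^ k m) *
      Polynomial.aeval x (Polynomial.hermite (zeta N k))

end GammaTail

namespace GammaTail

/-! ### A smoothing inequality -/

section Smoothing

open Complex

/-! The proof is the classical Fourier argument for Edgeworth expansions, with all constants uniform
in `M`.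

Write the normalized tail as `∑ a_j ξ_j` with `ξ_j` independent centred gamma variables, `a_j ≥ 0`
and `∑ a_j ^ 2 = r`. The law of `ξ_j` has the explicit exponent `-r log (1 - z/r) - z`, so near the
origin the logarithm of the characteristic function is a power series in `it`, with coefficients
`κ_m / m!`. Since `a_j ^ m ≤ a_j ^ 2 * (max a) ^ (m - 2)`, the `m`-th coefficient is at most `θ ^ (m
- 2)` with `θ = max a / r`.

Doubling estimates for `lam` show that `∑_{n ≥ M} lam n ^ 2` is comparable to `M * lam M ^ 2`. Hence
`max a` is of order at most `M ^ (-1/2)`, and the first `M` weights are at least a constant times `M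
^ (-1/2)`. The first fact makes the expected error `θ ^ (N - 1)` equal to `O(M ^ (-(N - 1)/2))`. The
second makes the characteristic function decay like any prescribed power of `1 + d t ^ 2`, with `d`
free of `M` (`norm_charFun_limit_le`, `rpow_neg_pow_le`).

The Edgeworth sum is the Fourier image of `exp (-t^2/2)` times the expansion of `exp (∑_{3 ≤ m ≤ N}
κ_m (it)^m / m!)` cut off at weight `N - 2`. For `θ |t| ≤ 1/16` the two transforms are compared term
by term (`norm_exp_sub_edgeworth_le`). For larger `t` both are small, and `(16 θ |t|) ^ (N - 1) ≥ 1`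
supplies the factor for free. The smoothing inequality `abs_measure_Iic_sub_le` turns this into a
uniform bound on distribution functions. Because the characteristic function is integrable against
the required powers, no frequency cutoff as in Esseen's inequality is needed. -/

theorem integral_exp_mul_gaussian {v : NNReal} (hv : v ≠ 0) (x y : ℝ) :
    ∫ t : ℝ, cexp (-(v / 2 : ℂ) * t ^ 2) * cexp (t * y * I) * cexp (-(t * x * I)) =
      2 * Real.pi * gaussianPDFReal y v x := by
  have hv' : 0 < (v : ℝ) := by positivity
  have h := fourierIntegral_gaussian (b := (v / 2 : ℂ)) (by simpa using hv') ((y : ℂ) - x)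
  have e : ∀ t : ℝ, cexp (-(v / 2 : ℂ) * t ^ 2) * cexp (t * y * I) * cexp (-(t * x * I)) =
      cexp (I * (y - x) * t) * cexp (-(v / 2 : ℂ) * t ^ 2) := by
    intro t
    rw [mul_assoc, ← Complex.exp_add, mul_comm]
    congr 2
    ring
  simp_rw [e]
  rw [h, gaussianPDFReal]
  have e1 : ((Real.pi : ℂ) / (v / 2)) ^ (1 / 2 : ℂ) = ((Real.sqrt (2 * Real.pi / v) : ℝ) : ℂ) := by
    rw [Real.sqrt_eq_rpow, Complex.ofReal_cpow (by positivity)]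
    push_cast
    congr 1
    field_simp
  have e2 : Real.sqrt (2 * Real.pi / v) = 2 * Real.pi * (Real.sqrt (2 * Real.pi * v))⁻¹ := by
    rw [Real.sqrt_div (by positivity), Real.sqrt_mul (by positivity) (v : ℝ)]
    have := Real.mul_self_sqrt (show 0 ≤ 2 * Real.pi by positivity)
    have h0 : Real.sqrt (2 * Real.pi) ≠ 0 := by positivity
    have h1 : Real.sqrt (v : ℝ) ≠ 0 := by positivity
    field_simp
    nlinarith
  rw [e1, e2]
  push_cast
  rw [← mul_assoc]
  congr 2
  field_simp
  ring

theorem norm_intervalIntegral_exp_le_sub {a b : ℝ} (hab : a ≤ b) (t : ℝ) :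
    ‖∫ x in a..b, cexp (-(t * x * I))‖ ≤ b - a := by
  have := intervalIntegral.norm_integral_le_of_norm_le_const (a := a) (b := b) (C := 1)
    (f := fun x : ℝ => cexp (-(t * x * I))) (fun x _ => by
      have : -((t : ℂ) * x * I) = ((-(t * x) : ℝ) : ℂ) * I := by push_cast; ring
      rw [this, norm_exp_ofReal_mul_I])
  rwa [one_mul, abs_of_nonneg (by linarith)] at this

/-- This bound does not see the length of the interval, so intervals may later be exhausted to
half-lines. The factor `1 / |t|` is what the hypothesis `B t * |t|` of the smoothing inequality
compensates. -/
theorem norm_intervalIntegral_exp_le_inv (a b : ℝ) {t : ℝ} (ht : t ≠ 0) :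
    ‖∫ x in a..b, cexp (-(t * x * I))‖ ≤ 2 / |t| := by
  have hc : -((t : ℂ) * I) ≠ 0 := by simp [ht]
  have e : ∀ x : ℝ, cexp (-(t * x * I)) = cexp (-((t : ℂ) * I) * x) := fun x => by
    congr 1; ring
  simp_rw [e]
  rw [integral_exp_mul_complex hc, norm_div]
  have h1 : ‖-((t : ℂ) * I)‖ = |t| := by simp
  rw [h1]
  gcongr
  refine (norm_sub_le _ _).trans ?_
  have : ∀ x : ℝ, ‖cexp (-((t : ℂ) * I) * x)‖ = 1 := fun x => by
    have : -((t : ℂ) * I) * x = ((-(t * x) : ℝ) : ℂ) * I := by push_cast; ring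
    rw [this, norm_exp_ofReal_mul_I]
  rw [this, this]
  norm_num

theorem continuous_intervalIntegral_exp (a b : ℝ) :
    Continuous fun t : ℝ => ∫ x in a..b, cexp (-(t * x * I)) :=
  intervalIntegral.continuous_parametric_intervalIntegral_of_continuous' (by fun_prop) a b

theorem integrable_cexp_neg_mul_sq {v : NNReal} (hv : v ≠ 0) :
    Integrable fun t : ℝ => cexp (-(v / 2 : ℂ) * t ^ 2) := by
  have hv' : 0 < (v : ℝ) := by positivity
  exact _root_.integrable_cexp_neg_mul_sq (b := (v / 2 : ℂ)) (by simpa using hv')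

/-- Fourier representation of the Gaussian mass of an interval. -/
theorem gaussianReal_Ioc_eq {v : NNReal} (hv : v ≠ 0) {a b : ℝ} (hab : a ≤ b) (y : ℝ) :
    (((gaussianReal y v).real (Set.Ioc a b) : ℝ) : ℂ) = (2 * Real.pi : ℂ)⁻¹ *
      ∫ t : ℝ, cexp (-(v / 2 : ℂ) * t ^ 2) * cexp (t * y * I) *
        ∫ x in a..b, cexp (-(t * x * I)) := by
  have hpi : (2 * Real.pi : ℂ) ≠ 0 := by simp [Real.pi_ne_zero]
  have hintg : Integrable (Function.uncurry fun (t x : ℝ) =>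
      cexp (-(v / 2 : ℂ) * t ^ 2) * cexp (t * y * I) * cexp (-(t * x * I)))
      (volume.prod (volume.restrict (Set.Ioc a b))) := by
    have h := (integrable_cexp_neg_mul_sq hv).mul_prod
      (integrable_const (1 : ℂ) (μ := volume.restrict (Set.Ioc a b)))
    refine h.mono (Continuous.aestronglyMeasurable (by fun_prop)) (ae_of_all _ fun p => ?_)
    obtain ⟨t, x⟩ := p
    simp only [Function.uncurry_apply_pair, norm_mul]
    have e1 : ‖cexp (t * y * I)‖ = 1 := by
      rw [← Complex.ofReal_mul, norm_exp_ofReal_mul_I]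
    have e2 : ‖cexp (-(t * x * I))‖ = 1 := by
      have : -((t : ℂ) * x * I) = ((-(t * x) : ℝ) : ℂ) * I := by push_cast; ring
      rw [this, norm_exp_ofReal_mul_I]
    rw [e1, e2]
    simp
  have h1 : ∫ t : ℝ, cexp (-(v / 2 : ℂ) * t ^ 2) * cexp (t * y * I) *
      ∫ x in a..b, cexp (-(t * x * I)) =
      ∫ x in Set.Ioc a b, (2 * Real.pi * gaussianPDFReal y v x : ℂ) := by
    simp_rw [intervalIntegral.integral_of_le hab, ← integral_const_mul]
    rw [integral_integral_swap hintg]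
    simp_rw [integral_exp_mul_gaussian hv]
  rw [h1, integral_const_mul, ← mul_assoc, inv_mul_cancel₀ hpi, one_mul, integral_complex_ofReal,
    measureReal_def, gaussianReal_apply_eq_integral _ hv, ENNReal.toReal_ofReal]
  exact integral_nonneg fun x => gaussianPDFReal_nonneg _ _ _

/-- Parseval's relation against the Gaussian mass of an interval. -/
theorem integral_gaussianReal_Ioc_mul {v : NNReal} (hv : v ≠ 0) {a b : ℝ} (hab : a ≤ b)
    (ν : Measure ℝ) [SFinite ν] {w : ℝ → ℝ} (hw : Integrable w ν) :
    ((∫ y, (gaussianReal y v).real (Set.Ioc a b) * w y ∂ν : ℝ) : ℂ) = (2 * Real.pi : ℂ)⁻¹ *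
      ∫ t : ℝ, cexp (-(v / 2 : ℂ) * t ^ 2) * (∫ x in a..b, cexp (-(t * x * I))) *
        ∫ y, cexp (t * y * I) * w y ∂ν := by
  rw [← integral_complex_ofReal]
  have e0 : ∀ y : ℝ, ((((gaussianReal y v).real (Set.Ioc a b) * w y : ℝ)) : ℂ) =
      (2 * Real.pi : ℂ)⁻¹ * ∫ t : ℝ, cexp (-(v / 2 : ℂ) * t ^ 2) *
        (cexp (t * y * I) * ∫ x in a..b, cexp (-(t * x * I))) * w y := by
    intro y
    rw [Complex.ofReal_mul, gaussianReal_Ioc_eq hv hab, integral_mul_const, mul_assoc]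
    congr 3
    ext t
    ring
  simp_rw [e0]
  rw [integral_const_mul]
  congr 1
  have hintg : Integrable (Function.uncurry fun (y t : ℝ) =>
      cexp (-(v / 2 : ℂ) * t ^ 2) * (cexp (t * y * I) * ∫ x in a..b, cexp (-(t * x * I))) * w y)
      (ν.prod volume) := by
    have h := hw.norm.mul_prod ((integrable_cexp_neg_mul_sq hv).norm.mul_const (b - a))
    have hc := continuous_intervalIntegral_exp a b
    refine h.mono ?_ (ae_of_all _ fun p => ?_)
    · refine AEStronglyMeasurable.mul (Continuous.aestronglyMeasurable ?_) ?_
      · exact Continuous.mul (by fun_prop) (Continuous.mul (by fun_prop) (hc.comp continuous_snd))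
      · exact (Complex.continuous_ofReal.comp_aestronglyMeasurable hw.1).comp_fst
    · obtain ⟨y, t⟩ := p
      simp only [Function.uncurry_apply_pair, norm_mul]
      have e1 : ‖cexp (t * y * I)‖ = 1 := by
        rw [← Complex.ofReal_mul, norm_exp_ofReal_mul_I]
      have := norm_intervalIntegral_exp_le_sub hab t
      have h0 : ‖b - a‖ = b - a := by rw [Real.norm_eq_abs, abs_of_nonneg (by linarith)]
      rw [e1, h0, norm_norm, norm_norm, one_mul, mul_comm, Complex.norm_real]
      gcongr
  rw [integral_integral_swap hintg]
  congr 1 with t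
  rw [← integral_const_mul]
  congr 1 with y
  ring

/-- A Gaussian of mean `y` and standard deviation `1 / (n + 1)` concentrates at `y`. The endpoints
are excluded because for `a < b` half of the mass falls outside the interval there. -/
theorem tendsto_gaussianReal_Ioc {a b y : ℝ} (hya : y ≠ a) (hyb : y ≠ b) :
    Tendsto (fun n : ℕ => (gaussianReal y (((1 : NNReal) / (n + 1)) ^ 2)).real (Set.Ioc a b)) atTop
      (𝓝 ((Set.Ioc a b).indicator 1 y)) := by
  have hmap : ∀ n : ℕ, (gaussianReal y (((1 : NNReal) / (n + 1)) ^ 2)).real (Set.Ioc a b) =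
      ∫ z, (Set.Ioc a b).indicator (1 : ℝ → ℝ) (y + (1 / ((n : ℝ) + 1)) * z)
        ∂(gaussianReal 0 1) := by
    intro n
    have h : gaussianReal y (((1 : NNReal) / (n + 1)) ^ 2) =
        (gaussianReal 0 1).map fun z => y + (1 / ((n : ℝ) + 1)) * z := by
      have := Measure.map_map (μ := gaussianReal 0 1) (g := fun z => y + z)
        (f := fun z => (1 / ((n : ℝ) + 1)) * z) (by fun_prop) (by fun_prop)
      rw [Function.comp_def] at this
      rw [← this, gaussianReal_map_const_mul, gaussianReal_map_const_add]
      congr 1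
      · simp
      · ext
        simp
    rw [h, ← integral_indicator_one measurableSet_Ioc, integral_map (by fun_prop)
      ((measurable_one.indicator measurableSet_Ioc).aestronglyMeasurable)]
  simp_rw [hmap]
  have hlim : ((Set.Ioc a b).indicator (1 : ℝ → ℝ) y) =
      ∫ z, (Set.Ioc a b).indicator (1 : ℝ → ℝ) y ∂(gaussianReal 0 1) := by simp
  rw [hlim]
  refine tendsto_integral_of_dominated_convergence (fun _ => 1) (fun n => ?_) (integrable_const _)
    (fun n => ae_of_all _ fun z => ?_) (ae_of_all _ fun z => ?_)
  · exact ((measurable_one.indicator measurableSet_Ioc).comp (by fun_prop)).aestronglyMeasurable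
  · rw [Set.indicator_apply]
    split_ifs <;> simp
  · have ht : Tendsto (fun n : ℕ => y + 1 / ((n : ℝ) + 1) * z) atTop (𝓝 y) := by
      have := (tendsto_one_div_add_atTop_nhds_zero_nat (𝕜 := ℝ)).mul_const z
      simpa using this.const_add y
    refine Tendsto.comp (ContinuousAt.tendsto ?_) ht
    refine ContinuousOn.continuousAt_indicator ?_ ?_ 
    · exact continuousOn_const
    · rcases le_or_gt a b with hab | hab
      · rcases hab.eq_or_lt with rfl | hab
        · simp
        · rw [frontier_Ioc hab]
          simp [hya, hyb]
      · simp [Set.Ioc_eq_empty_of_le hab.le]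

theorem tendsto_integral_gaussianReal_Ioc {a b : ℝ} (ν : Measure ℝ) [SFinite ν] (ha : ν {a} = 0)
    (hb : ν {b} = 0) {w : ℝ → ℝ} (hw : Integrable w ν) :
    Tendsto (fun n : ℕ => ∫ y, (gaussianReal y (((1 : NNReal) / (n + 1)) ^ 2)).real (Set.Ioc a b) *
      w y ∂ν) atTop (𝓝 (∫ y in Set.Ioc a b, w y ∂ν)) := by
  have hlim : ∫ y in Set.Ioc a b, w y ∂ν = ∫ y, (Set.Ioc a b).indicator 1 y * w y ∂ν := by
    rw [← integral_indicator measurableSet_Ioc]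
    congr 1 with y
    by_cases h : y ∈ Set.Ioc a b <;> simp [h]
  rw [hlim]
  refine tendsto_integral_of_dominated_convergence (fun y => ‖w y‖) (fun n => ?_) hw.norm
    (fun n => ae_of_all _ fun y => ?_) ?_
  · refine AEStronglyMeasurable.mul ?_ hw.1
    have hv : (((1 : NNReal) / (n + 1)) ^ 2) ≠ 0 := by positivity
    rcases le_or_gt a b with hab | hab
    · have : (fun y => (gaussianReal y (((1 : NNReal) / (n + 1)) ^ 2)).real (Set.Ioc a b)) =
          fun y => (((gaussianReal y (((1 : NNReal) / (n + 1)) ^ 2)).real (Set.Ioc a b) : ℝ) : ℂ).re :=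
        by simp
      rw [this]
      simp_rw [gaussianReal_Ioc_eq hv hab]
      refine (Complex.continuous_re.measurable.comp
        (measurable_const.mul (StronglyMeasurable.measurable ?_))).aestronglyMeasurable
      refine StronglyMeasurable.integral_prod_right (f := fun (y t : ℝ) =>
        cexp (-((((1 : NNReal) / (n + 1)) ^ 2 : NNReal) / 2 : ℂ) * t ^ 2) * cexp (t * y * I) *
          ∫ x in a..b, cexp (-(t * x * I))) ?_
      refine Continuous.stronglyMeasurable ?_
      exact Continuous.mul (by fun_prop) ((continuous_intervalIntegral_exp a b).comp continuous_snd)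
    · simp only [Set.Ioc_eq_empty_of_le hab.le, measureReal_empty]
      exact aestronglyMeasurable_const
  · rw [norm_mul]
    refine mul_le_of_le_one_left (norm_nonneg _) ?_
    rw [Real.norm_eq_abs, abs_of_nonneg measureReal_nonneg]
    exact measureReal_le_one
  · have h1 : ∀ᵐ y ∂ν, y ≠ a := by rw [ae_iff]; simpa using ha
    have h2 : ∀ᵐ y ∂ν, y ≠ b := by rw [ae_iff]; simpa using hb
    filter_upwards [h1, h2] with y hya hyb
    exact (tendsto_gaussianReal_Ioc hya hyb).mul_const _

/-- Smooth the indicator of the interval by a narrow Gaussian. Parseval's relation then bounds the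
difference by `(2π)⁻¹ ∫ (2 / |t|) * (B t * |t|)`, uniformly in the variance, because the Gaussian
factor has modulus at most one. Letting the variance tend to zero recovers the interval, provided
its endpoints carry no mass. -/
theorem abs_measure_Ioc_sub_le {μ : Measure ℝ} [IsProbabilityMeasure μ] {g B : ℝ → ℝ}
    (hg : Integrable g) (hB : Integrable B)
    (hD : ∀ t, t ≠ 0 → ‖charFun μ t - ∫ x : ℝ, cexp (t * x * I) * g x‖ ≤ B t * |t|)
    {a b : ℝ} (hab : a ≤ b) (ha : μ {a} = 0) (hb : μ {b} = 0) :
    |μ.real (Set.Ioc a b) - ∫ x in Set.Ioc a b, g x| ≤ Real.pi⁻¹ * ∫ t, B t := by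
  have l1 := tendsto_integral_gaussianReal_Ioc μ ha hb (integrable_const (1 : ℝ))
  have l2 := tendsto_integral_gaussianReal_Ioc volume (Real.volume_singleton (a := a))
    (Real.volume_singleton (a := b)) hg
  have l3 := (l1.sub l2).abs
  have e0 : ∫ y in Set.Ioc a b, (1 : ℝ) ∂μ = μ.real (Set.Ioc a b) := by simp
  rw [e0] at l3
  refine le_of_tendsto l3 (Eventually.of_forall fun n => ?_)
  have hv : (((1 : NNReal) / (n + 1)) ^ 2) ≠ 0 := by positivity
  set v : NNReal := ((1 : NNReal) / (n + 1)) ^ 2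
  rw [← Real.norm_eq_abs, ← Complex.norm_real, Complex.ofReal_sub,
    integral_gaussianReal_Ioc_mul hv hab μ (integrable_const (1 : ℝ)),
    integral_gaussianReal_Ioc_mul hv hab volume hg, ← mul_sub]
  have hE := continuous_intervalIntegral_exp a b
  have hi : ∀ F : ℝ → ℂ, Measurable F → (∃ C, ∀ t, ‖F t‖ ≤ C) → Integrable fun t : ℝ =>
      cexp (-(v / 2 : ℂ) * t ^ 2) * (∫ x in a..b, cexp (-(t * x * I))) * F t := by
    rintro F hF ⟨C, hC⟩
    refine ((integrable_cexp_neg_mul_sq hv).mul_bdd (c := b - a) hE.aestronglyMeasurable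
      (ae_of_all _ fun t => norm_intervalIntegral_exp_le_sub hab t)).mul_bdd (c := C)
      hF.aestronglyMeasurable (ae_of_all _ hC)
  have hnorm : ∀ t y : ℝ, ‖cexp (t * y * I)‖ = 1 := fun t y => by
    rw [← Complex.ofReal_mul, norm_exp_ofReal_mul_I]
  have i1 := hi (fun t => ∫ y, cexp (t * y * I) * ((1 : ℝ) : ℂ) ∂μ)
    (by simpa [← charFun_apply_real] using measurable_charFun)
    ⟨1, fun t => by
      simp only [Complex.ofReal_one, mul_one, ← charFun_apply_real]
      exact norm_charFun_le_one t⟩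
  have i2 := hi (fun t => ∫ y : ℝ, cexp (t * y * I) * g y) (by
      refine StronglyMeasurable.measurable ?_
      obtain ⟨g', hg', hgg⟩ := hg.1
      have : (fun t : ℝ => ∫ y : ℝ, cexp (t * y * I) * g y) =
          fun t : ℝ => ∫ y : ℝ, cexp (t * y * I) * g' y := by
        ext t
        refine integral_congr_ae ?_
        filter_upwards [hgg] with y hy
        rw [hy]
      rw [this]
      refine StronglyMeasurable.integral_prod_right
        (f := fun (t y : ℝ) => cexp (t * y * I) * g' y) ?_
      exact StronglyMeasurable.mul (Continuous.stronglyMeasurable (by fun_prop))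
        (Complex.measurable_ofReal.comp (hg'.measurable.comp measurable_snd)).stronglyMeasurable)
    ⟨∫ y, ‖g y‖, fun t => by
      refine (norm_integral_le_integral_norm _).trans_eq ?_
      simp [hnorm]⟩
  rw [← integral_sub i1 i2, norm_mul]
  have hc : ‖(2 * Real.pi : ℂ)⁻¹‖ = Real.pi⁻¹ * 2⁻¹ := by
    simp [abs_of_pos Real.pi_pos]
  rw [hc, mul_assoc]
  refine mul_le_mul_of_nonneg_left ?_ (by positivity)
  rw [inv_mul_le_iff₀ (by norm_num), ← integral_const_mul]
  refine norm_integral_le_of_norm_le (hB.const_mul 2) ?_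
  have h0 : ∀ᵐ t : ℝ, t ≠ 0 := by rw [ae_iff]; simp
  filter_upwards [h0] with t ht
  rw [← mul_sub, norm_mul, norm_mul]
  have h1 : ‖cexp (-(v / 2 : ℂ) * t ^ 2)‖ ≤ 1 := by
    rw [Complex.norm_exp]
    have : (-(v / 2 : ℂ) * t ^ 2) = ((-(v / 2) * t ^ 2 : ℝ) : ℂ) := by push_cast; ring
    rw [this, Complex.ofReal_re, Real.exp_le_one_iff]
    have : 0 ≤ (v : ℝ) / 2 * t ^ 2 := by positivity
    linarith
  have h2 := norm_intervalIntegral_exp_le_inv a b ht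
  have h3 := hD t ht
  simp only [Complex.ofReal_one, mul_one, ← charFun_apply_real]
  calc _ ≤ 1 * (2 / |t|) * (B t * |t|) := by gcongr
    _ = 2 * B t := by
      have : |t| ≠ 0 := abs_ne_zero.mpr ht
      field_simp

/-- **Smoothing inequality**: the Kolmogorov distance is controlled by the difference of the Fourier
transforms. -/
theorem abs_measure_Iic_sub_le {μ : Measure ℝ} [IsProbabilityMeasure μ] {g B : ℝ → ℝ}
    (hg : Integrable g) (hB : Integrable B)
    (hD : ∀ t, t ≠ 0 → ‖charFun μ t - ∫ x : ℝ, cexp (t * x * I) * g x‖ ≤ B t * |t|) (x : ℝ) :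
    |μ.real (Set.Iic x) - ∫ y in Set.Iic x, g y| ≤ Real.pi⁻¹ * ∫ t, B t := by
  -- Only countably many points are atoms, so endpoints without mass can be chosen with `a n → -∞`
  -- and `b n → x` from the right. Approaching from the right keeps `x` itself inside every
  -- interval.
  have hcount : {y : ℝ | 0 < μ {y}}.Countable :=
    Measure.countable_meas_pos_of_disjoint_iUnion (fun _ => measurableSet_singleton _)
      fun i j hij => by simpa [Function.onFun] using hij
  have hdense := hcount.dense_compl ℝ
  have hex : ∀ p q : ℝ, p < q → ∃ y, p < y ∧ y < q ∧ μ {y} = 0 := by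
    intro p q hpq
    obtain ⟨y, hy, hy'⟩ := hdense.exists_between hpq
    exact ⟨y, hy'.1, hy'.2, by simpa using hy⟩
  choose a ha1 ha2 ha3 using fun n : ℕ => hex (x - n - 1) (x - n) (by linarith)
  choose b hb1 hb2 hb3 using fun n : ℕ => hex x (x + 1 / ((n : ℝ) + 1))
    (by have : 0 < 1 / ((n : ℝ) + 1) := by positivity
        linarith)
  have hind : ∀ y, Tendsto (fun n => (Set.Ioc (a n) (b n)).indicator (1 : ℝ → ℝ) y) atTop
      (𝓝 ((Set.Iic x).indicator 1 y)) := by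
    intro y
    refine tendsto_const_nhds.congr' ?_
    by_cases hy : y ≤ x
    · obtain ⟨k, hk⟩ := exists_nat_gt (x - y)
      filter_upwards [eventually_ge_atTop k] with n hn
      have hn' : (k : ℝ) ≤ n := by exact_mod_cast hn
      have : y ∈ Set.Ioc (a n) (b n) := ⟨by linarith [ha2 n], hy.trans (hb1 n).le⟩
      simp [this, hy]
    · push Not at hy
      have := (tendsto_one_div_add_atTop_nhds_zero_nat (𝕜 := ℝ)).eventually_lt_const (sub_pos.mpr hy)
      filter_upwards [this] with n hn
      have : y ∉ Set.Ioc (a n) (b n) := fun h => by linarith [hb2 n, h.2]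
      simp [this, hy]
  have key : ∀ (ν : Measure ℝ) (w : ℝ → ℝ), Integrable w ν →
      Tendsto (fun n => ∫ y in Set.Ioc (a n) (b n), w y ∂ν) atTop
        (𝓝 (∫ y in Set.Iic x, w y ∂ν)) := by
    intro ν w hw
    have e : ∀ s : Set ℝ, MeasurableSet s → ∫ y in s, w y ∂ν = ∫ y, s.indicator 1 y * w y ∂ν := by
      intro s hs
      rw [← integral_indicator hs]
      congr 1 with y
      by_cases h : y ∈ s <;> simp [h]
    simp_rw [e _ measurableSet_Ioc, e _ measurableSet_Iic]
    refine tendsto_integral_of_dominated_convergence (fun y => ‖w y‖) (fun n => ?_) hw.norm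
      (fun n => ae_of_all _ fun y => ?_) (ae_of_all _ fun y => (hind y).mul_const _)
    · exact ((measurable_one.indicator measurableSet_Ioc).aestronglyMeasurable).mul hw.1
    · by_cases h : y ∈ Set.Ioc (a n) (b n) <;> simp [h]
  have l := ((key μ 1 (integrable_const 1)).sub (key volume g hg)).abs
  have e0 : ∀ s : Set ℝ, ∫ y in s, (1 : ℝ → ℝ) y ∂μ = μ.real s := fun s => by simp
  simp_rw [e0] at l
  refine le_of_tendsto l (Eventually.of_forall fun n => ?_)
  refine abs_measure_Ioc_sub_le hg hB hD ?_ (ha3 n) (hb3 n)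
  have := ha2 n
  have := hb1 n
  have : (0 : ℝ) ≤ n := by positivity
  linarith

end Smoothing

end GammaTail

namespace GammaTail

/-! ### Hermite functions and the Edgeworth density -/

section Hermite

open Complex

/-- The Hermite function: the standard Gaussian density times the `n`-th Hermite polynomial. -/
noncomputable def hermiteFun (n : ℕ) (x : ℝ) : ℝ :=
  gaussianPDFReal 0 1 x * Polynomial.aeval x (Polynomial.hermite n)

theorem hermiteFun_zero : hermiteFun 0 = gaussianPDFReal 0 1 := by
  ext x
  simp [hermiteFun]

theorem gaussianPDFReal_zero_one (x : ℝ) :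
    gaussianPDFReal 0 1 x = (Real.sqrt (2 * Real.pi))⁻¹ * Real.exp (-(1 / 2) * x ^ 2) := by
  rw [gaussianPDFReal]
  simp only [NNReal.coe_one, mul_one, sub_zero]
  congr 2
  ring

theorem hasDerivAt_hermiteFun (n : ℕ) (x : ℝ) :
    HasDerivAt (hermiteFun n) (-hermiteFun (n + 1) x) x := by
  have h1 : HasDerivAt (gaussianPDFReal 0 1) (-(x * gaussianPDFReal 0 1 x)) x := by
    have e : gaussianPDFReal 0 1 = fun x =>
        (Real.sqrt (2 * Real.pi))⁻¹ * Real.exp (-(1 / 2) * x ^ 2) :=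
      funext gaussianPDFReal_zero_one
    rw [gaussianPDFReal_zero_one, e]
    have := (((hasDerivAt_pow 2 x).const_mul (-(1 / 2) : ℝ)).exp).const_mul
      ((Real.sqrt (2 * Real.pi))⁻¹)
    refine this.congr_deriv ?_
    push_cast
    ring
  have h2 := Polynomial.hasDerivAt_aeval (Polynomial.hermite n) x
  refine (h1.mul h2).congr_deriv ?_
  simp only [hermiteFun, Polynomial.hermite_succ, map_sub, map_mul, Polynomial.aeval_X]
  ring

theorem integrable_hermiteFun (n : ℕ) : Integrable (hermiteFun n) := by
  have h : hermiteFun n = fun x : ℝ => ∑ i ∈ Finset.range ((Polynomial.hermite n).natDegree + 1),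
      ((Real.sqrt (2 * Real.pi))⁻¹ * ((Polynomial.hermite n).coeff i : ℝ)) *
        (x ^ (i : ℝ) * Real.exp (-(1 / 2) * x ^ 2)) := by
    ext x
    rw [hermiteFun, gaussianPDFReal_zero_one, Polynomial.aeval_eq_sum_range, Finset.mul_sum]
    refine Finset.sum_congr rfl fun i _ => ?_
    rw [Real.rpow_natCast, zsmul_eq_mul]
    ring
  rw [h]
  refine integrable_finsetSum _ fun i _ => Integrable.const_mul ?_ _
  exact integrable_rpow_mul_exp_neg_mul_sq (by norm_num) (by linarith [(Nat.cast_nonneg i : (0 : ℝ) ≤ i)])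

/-- Integration lowers the Hermite index by one and changes the sign. This accounts for the `- 1` in
`zeta` and for the minus sign in front of the sum in `edgeworth`. -/
theorem integral_Iic_hermiteFun_succ (n : ℕ) (x : ℝ) :
    ∫ y in Set.Iic x, hermiteFun (n + 1) y = -hermiteFun n x := by
  have hd : ∀ y, HasDerivAt (fun y => -hermiteFun n y) (hermiteFun (n + 1) y) y := fun y => by
    exact (hasDerivAt_hermiteFun n y).neg.congr_deriv (neg_neg _)
  have := integral_Iic_of_hasDerivAt_of_tendsto (a := x) (hd x).continuousAt.continuousWithinAt
    (fun y _ => hd y) (integrable_hermiteFun (n + 1)).integrableOn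
    (tendsto_zero_of_hasDerivAt_of_integrableOn_Iic (a := x) (fun y _ => hd y)
      (integrable_hermiteFun (n + 1)).integrableOn (integrable_hermiteFun n).neg.integrableOn)
  simpa using this

theorem integrable_exp_mul_hermiteFun (t : ℝ) (n : ℕ) :
    Integrable fun x : ℝ => cexp (t * x * I) * hermiteFun n x := by
  refine (integrable_hermiteFun n).ofReal.bdd_mul (c := 1)
    (Continuous.aestronglyMeasurable (by fun_prop)) (ae_of_all _ fun x => ?_)
  rw [← Complex.ofReal_mul, norm_exp_ofReal_mul_I]

/-- The Fourier transform of the Hermite functions. -/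
theorem integral_exp_mul_hermiteFun (t : ℝ) (n : ℕ) :
    ∫ x : ℝ, cexp (t * x * I) * hermiteFun n x = (t * I) ^ n * cexp (-(t ^ 2 / 2)) := by
  induction n with
  | zero =>
    have h := charFun_gaussianReal (μ := 0) (v := 1) t
    rw [charFun_apply_real, integral_gaussianReal_eq_integral_smul one_ne_zero] at h
    simp only [hermiteFun_zero, pow_zero, one_mul]
    simp only [Complex.real_smul] at h
    simp_rw [mul_comm (cexp _)]
    rw [h]
    simp
  | succ n ih =>
    have hu : ∀ x : ℝ, HasDerivAt (fun x : ℝ => cexp (t * x * I)) (cexp (t * x * I) * (t * I)) x := by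
      intro x
      have h1 : HasDerivAt (fun x : ℝ => (t * x * I : ℂ)) (t * I) x := by
        have := ((hasDerivAt_id x).ofReal_comp.const_mul (t : ℂ)).mul_const I
        simpa using this
      exact h1.cexp
    have hv : ∀ x : ℝ, HasDerivAt (fun x : ℝ => (hermiteFun n x : ℂ))
        ((-hermiteFun (n + 1) x : ℝ) : ℂ) x := fun x => (hasDerivAt_hermiteFun n x).ofReal_comp
    have i1 : Integrable ((fun x : ℝ => cexp (t * x * I)) *
        fun x : ℝ => ((-hermiteFun (n + 1) x : ℝ) : ℂ)) := by
      have := (integrable_exp_mul_hermiteFun t (n + 1)).neg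
      refine this.congr (ae_of_all _ fun x => ?_)
      simp
    have i2 : Integrable ((fun x : ℝ => cexp (t * x * I) * (t * I)) *
        fun x : ℝ => (hermiteFun n x : ℂ)) := by
      have := (integrable_exp_mul_hermiteFun t n).mul_const (t * I)
      refine this.congr (ae_of_all _ fun x => ?_)
      simp only [Pi.mul_apply]
      ring
    have key := integral_mul_deriv_eq_deriv_mul_of_integrable (fun x _ => hu x)
      (fun x _ => hv x) i1 i2
      (integrable_exp_mul_hermiteFun t n)
    have e1 : ∫ x : ℝ, cexp (t * x * I) * ((-hermiteFun (n + 1) x : ℝ) : ℂ) =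
        -∫ x : ℝ, cexp (t * x * I) * hermiteFun (n + 1) x := by
      rw [← integral_neg]
      congr 1 with x
      push_cast
      ring
    have e2 : ∫ x : ℝ, cexp (t * x * I) * (t * I) * hermiteFun n x =
        (t * I) * ∫ x : ℝ, cexp (t * x * I) * hermiteFun n x := by
      rw [← integral_const_mul]
      congr 1 with x
      ring
    rw [e1, e2, ih, neg_inj] at key
    rw [key]
    ring

/-- The coefficient of a Hermite function in the Edgeworth density. -/
noncomputable def edgeworthCoeff (N : ℕ) (κ : ℕ → ℝ) (k : Finset.Icc 3 N → ℕ) : ℝ :=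
  ∏ m : Finset.Icc 3 N, 1 / ((k m).factorial : ℝ) * (κ m / ((m : ℕ).factorial : ℝ)) ^ k m

/-- The derivative of the Edgeworth approximation. -/
noncomputable def edgeworthDensity (N : ℕ) (κ : ℕ → ℝ) (x : ℝ) : ℝ :=
  hermiteFun 0 x + ∑ k ∈ indexSet N, edgeworthCoeff N κ k * hermiteFun (zeta N k + 1) x

theorem integrable_edgeworthDensity (N : ℕ) (κ : ℕ → ℝ) : Integrable (edgeworthDensity N κ) :=
  (integrable_hermiteFun 0).add
    (integrable_finsetSum _ fun _ _ => (integrable_hermiteFun _).const_mul _)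

theorem integral_Iic_edgeworthDensity (N : ℕ) (κ : ℕ → ℝ) (x : ℝ) :
    ∫ y in Set.Iic x, edgeworthDensity N κ y = edgeworth N κ x := by
  simp only [edgeworthDensity]
  rw [integral_add (integrable_hermiteFun 0).integrableOn
    (integrable_finsetSum _ fun _ _ => (integrable_hermiteFun _).const_mul _).integrableOn,
    integral_finsetSum _ fun _ _ => ((integrable_hermiteFun _).const_mul _).integrableOn]
  simp_rw [integral_const_mul, integral_Iic_hermiteFun_succ]
  rw [edgeworth, hermiteFun_zero, cdf_eq_real, measureReal_def,
    gaussianReal_apply_eq_integral _ one_ne_zero, ENNReal.toReal_ofReal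
      (integral_nonneg fun x => gaussianPDFReal_nonneg _ _ _), Finset.mul_sum, sub_eq_add_neg,
    ← Finset.sum_neg_distrib]
  congr 1
  refine Finset.sum_congr rfl fun k _ => ?_
  rw [edgeworthCoeff, hermiteFun]
  ring

/-- The truncated subtraction in `zeta` is harmless because an index tuple has weight at least one,
so the sum is positive. -/
theorem zeta_add_one {N : ℕ} {k : Finset.Icc 3 N → ℕ} (hk : k ∈ indexSet N) :
    zeta N k + 1 = ∑ m : Finset.Icc 3 N, (m : ℕ) * k m := by
  have h := ((mem_indexSet N k).mp hk).1
  have h2 : weight N k ≤ ∑ m : Finset.Icc 3 N, (m : ℕ) * k m :=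
    Finset.sum_le_sum fun m _ => Nat.mul_le_mul_right _ (Nat.sub_le _ _)
  rw [zeta]
  omega

/-- The Fourier transform of the Edgeworth density. -/
theorem integral_exp_mul_edgeworthDensity (N : ℕ) (κ : ℕ → ℝ) (t : ℝ) :
    ∫ x : ℝ, cexp (t * x * I) * edgeworthDensity N κ x = cexp (-(t ^ 2 / 2)) *
      (1 + ∑ k ∈ indexSet N, ∏ m : Finset.Icc 3 N,
        ((κ m / (m : ℕ).factorial : ℝ) * (t * I) ^ (m : ℕ)) ^ k m / (k m).factorial) := by
  have e : ∀ x : ℝ, cexp (t * x * I) * edgeworthDensity N κ x =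
      cexp (t * x * I) * hermiteFun 0 x + ∑ k ∈ indexSet N,
        (edgeworthCoeff N κ k : ℂ) * (cexp (t * x * I) * hermiteFun (zeta N k + 1) x) := by
    intro x
    rw [edgeworthDensity]
    push_cast
    rw [mul_add, Finset.mul_sum]
    congr 1
    refine Finset.sum_congr rfl fun k _ => ?_
    ring
  simp_rw [e]
  rw [integral_add (integrable_exp_mul_hermiteFun t 0)
    (integrable_finsetSum _ fun _ _ => (integrable_exp_mul_hermiteFun t _).const_mul _),
    integral_finsetSum _ fun _ _ => (integrable_exp_mul_hermiteFun t _).const_mul _]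
  simp_rw [integral_const_mul, integral_exp_mul_hermiteFun]
  rw [mul_add, Finset.mul_sum]
  congr 1
  · simp
  refine Finset.sum_congr rfl fun k hk => ?_
  rw [zeta_add_one hk, ← Finset.prod_pow_eq_pow_sum, edgeworthCoeff]
  push_cast
  rw [← mul_assoc, ← Finset.prod_mul_distrib, mul_comm]
  congr 1
  refine Finset.prod_congr rfl fun m _ => ?_
  rw [pow_mul, mul_pow]
  ring

end Hermite

end GammaTail

namespace GammaTail

/-! ### Truncated exponentials -/

section Truncation

open Complex

/-- A tuple of weight at most `N - 2` has entries at most `N - 2`, so the box of side `K ≥ N - 1`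
contains them all. The zero tuple gives the leading `1` of the expansion. -/
theorem filter_weight_le_eq {N K : ℕ} (hN : 2 ≤ N) (hK : N - 1 ≤ K) :
    (Fintype.piFinset fun _ : Finset.Icc 3 N => Finset.range K).filter
      (fun k => weight N k ≤ N - 2) = insert 0 (indexSet N) := by
  ext k
  rw [Finset.mem_filter, Finset.mem_insert, mem_indexSet]
  have h0 : weight N k = 0 ↔ k = 0 := by
    rw [weight, Finset.sum_eq_zero_iff]
    constructor
    · intro h
      ext m
      have h3 : 3 ≤ (m : ℕ) := (Finset.mem_Icc.mp m.2).1
      have := h m (Finset.mem_univ _)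
      rcases Nat.mul_eq_zero.mp this with h' | h'
      · omega
      · simpa using h'
    · rintro rfl m -
      simp
  constructor
  · rintro ⟨-, h⟩
    by_cases hk : k = 0
    · exact Or.inl hk
    · have := mt h0.mp hk
      exact Or.inr ⟨by omega, h⟩
  · rintro (rfl | h)
    · refine ⟨?_, by rw [h0.mpr rfl]; exact Nat.zero_le _⟩
      rw [Fintype.mem_piFinset]
      intro m
      simp only [Pi.zero_apply, Finset.mem_range]
      omega
    · refine ⟨?_, h.2⟩
      have := (mem_indexSet N k).mpr h
      rw [indexSet, Finset.mem_filter, Fintype.mem_piFinset] at this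
      rw [Fintype.mem_piFinset]
      intro m
      have := this.1 m
      rw [Finset.mem_range] at this ⊢
      omega

theorem zero_notMem_indexSet (N : ℕ) : 0 ∉ indexSet N := by
  rw [mem_indexSet]
  simp [weight]

/-- Rankin's trick: every discarded tuple has weight at least `N - 1`, so multiplying its term by `ρ
^ (weight - (N - 1)) ≥ 1` only increases it. Extending the sum to the whole box, the weighted terms
factor into partial sums of exponentials. The cutoff `K` keeps all sums finite and is sent to
infinity afterwards. -/
theorem norm_prod_sum_sub_trunc_le {N K : ℕ} (hN : 2 ≤ N) (hK : N - 1 ≤ K)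
    (x : Finset.Icc 3 N → ℂ) {ρ : ℝ} (hρ : 1 ≤ ρ) :
    ‖∏ m, ∑ i ∈ Finset.range K, x m ^ i / i.factorial -
      (1 + ∑ k ∈ indexSet N, ∏ m, x m ^ k m / (k m).factorial)‖ ≤
      ρ⁻¹ ^ (N - 1) * Real.exp (∑ m, ‖x m‖ * ρ ^ ((m : ℕ) - 2)) := by
  have hρ0 : 0 < ρ := by linarith
  have h1 : 1 + ∑ k ∈ indexSet N, ∏ m, x m ^ k m / (k m).factorial =
      ∑ k ∈ (Fintype.piFinset fun _ : Finset.Icc 3 N => Finset.range K).filter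
        (fun k => weight N k ≤ N - 2), ∏ m, x m ^ k m / (k m).factorial := by
    rw [filter_weight_le_eq hN hK, Finset.sum_insert (zero_notMem_indexSet N)]
    simp
  rw [Finset.prod_univ_sum, h1, ← Finset.sum_filter_add_sum_filter_not _
    (fun k => weight N k ≤ N - 2), add_sub_cancel_left]
  have h2 : ∀ k : Finset.Icc 3 N → ℕ, ¬ weight N k ≤ N - 2 →
      ‖∏ m, x m ^ k m / (k m).factorial‖ ≤ ρ⁻¹ ^ (N - 1) *
        ∏ m, (‖x m‖ * ρ ^ ((m : ℕ) - 2)) ^ k m / (k m).factorial := by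
    intro k hk
    have e : ∏ m, (‖x m‖ * ρ ^ ((m : ℕ) - 2)) ^ k m / (k m).factorial =
        ρ ^ weight N k * ∏ m, ‖x m‖ ^ k m / (k m).factorial := by
      rw [weight, ← Finset.prod_pow_eq_pow_sum, ← Finset.prod_mul_distrib]
      refine Finset.prod_congr rfl fun m _ => ?_
      rw [mul_pow, pow_mul]
      ring
    have e2 : ‖∏ m, x m ^ k m / (k m).factorial‖ = ∏ m, ‖x m‖ ^ k m / (k m).factorial := by
      rw [norm_prod]
      refine Finset.prod_congr rfl fun m _ => ?_
      simp
    rw [e, e2, ← mul_assoc]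
    refine le_mul_of_one_le_left (Finset.prod_nonneg fun m _ => by positivity) ?_
    rw [inv_pow, inv_mul_eq_div, one_le_div (by positivity)]
    exact pow_le_pow_right₀ hρ (by omega)
  calc _ ≤ ∑ k ∈ (Fintype.piFinset fun _ : Finset.Icc 3 N => Finset.range K).filter
        (fun k => ¬ weight N k ≤ N - 2), ρ⁻¹ ^ (N - 1) *
        ∏ m, (‖x m‖ * ρ ^ ((m : ℕ) - 2)) ^ k m / (k m).factorial :=
        norm_sum_le_of_le _ fun k hk => h2 k (Finset.mem_filter.mp hk).2
    _ ≤ ∑ k ∈ (Fintype.piFinset fun _ : Finset.Icc 3 N => Finset.range K), ρ⁻¹ ^ (N - 1) *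
        ∏ m, (‖x m‖ * ρ ^ ((m : ℕ) - 2)) ^ k m / (k m).factorial :=
        Finset.sum_le_sum_of_subset_of_nonneg (Finset.filter_subset _ _) fun k _ _ =>
          mul_nonneg (by positivity) (Finset.prod_nonneg fun m _ => by positivity)
    _ = ρ⁻¹ ^ (N - 1) * ∏ m : Finset.Icc 3 N, ∑ i ∈ Finset.range K,
        (‖x m‖ * ρ ^ ((m : ℕ) - 2)) ^ i / i.factorial := by
        rw [← Finset.mul_sum, Finset.prod_univ_sum]
    _ ≤ ρ⁻¹ ^ (N - 1) * ∏ m : Finset.Icc 3 N, Real.exp (‖x m‖ * ρ ^ ((m : ℕ) - 2)) := by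
        gcongr with m _
        exact Real.sum_le_exp_of_nonneg (by positivity) K
    _ = _ := by rw [Real.exp_sum]

/-- The error of truncating the expansion of `exp (∑ x m)` at weight `N - 2`. -/
theorem norm_exp_sum_sub_trunc_le {N : ℕ} (hN : 2 ≤ N) (x : Finset.Icc 3 N → ℂ) {ρ : ℝ}
    (hρ : 1 ≤ ρ) :
    ‖cexp (∑ m, x m) - (1 + ∑ k ∈ indexSet N, ∏ m, x m ^ k m / (k m).factorial)‖ ≤
      ρ⁻¹ ^ (N - 1) * Real.exp (∑ m, ‖x m‖ * ρ ^ ((m : ℕ) - 2)) := by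
  have hlim : Tendsto (fun K : ℕ => ∏ m, ∑ i ∈ Finset.range K, x m ^ i / i.factorial) atTop
      (𝓝 (cexp (∑ m, x m))) := by
    rw [Complex.exp_sum]
    refine tendsto_finsetProd _ fun m _ => ?_
    have := (NormedSpace.expSeries_div_hasSum_exp (x m)).tendsto_sum_nat
    rwa [← Complex.exp_eq_exp_ℂ] at this
  refine le_of_tendsto (hlim.sub_const _).norm ?_
  filter_upwards [eventually_ge_atTop (N - 1)] with K hK
  exact norm_prod_sum_sub_trunc_le hN hK x hρ

theorem sum_Icc_pow_le (N : ℕ) :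
    ∑ m : Finset.Icc 3 N, (1 / 16 : ℝ) ^ ((m : ℕ) - 2) ≤ 1 / 8 := by
  rw [Finset.sum_coe_sort (Finset.Icc 3 N) fun m => (1 / 16 : ℝ) ^ (m - 2)]
  -- The subtracted term strengthens the bound enough for the induction to close.
  have h : ∀ n : ℕ, ∑ m ∈ Finset.Ico 3 (3 + n), (1 / 16 : ℝ) ^ (m - 2) ≤
      1 / 8 - (1 / 8) * (1 / 16) ^ n := by
    intro n
    induction n with
    | zero => simp
    | succ n ih =>
      rw [← add_assoc, Finset.sum_Ico_succ_top (by omega), show 3 + n - 2 = n + 1 by omega,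
        pow_succ]
      have : (0 : ℝ) ≤ (1 / 16) ^ n := by positivity
      linarith
  refine (Finset.sum_le_sum_of_subset_of_nonneg (t := Finset.Ico 3 (3 + N)) ?_
    fun _ _ _ => by positivity).trans ((h N).trans ?_)
  · intro m hm
    rw [Finset.mem_Icc] at hm
    rw [Finset.mem_Ico]
    omega
  · have : (0 : ℝ) ≤ (1 / 16) ^ N := by positivity
    linarith

theorem sum_range_eq_quadratic_add {N : ℕ} (hN : 2 ≤ N) {c : ℕ → ℝ} (h0 : c 0 = 0) (h1 : c 1 = 0)
    (h2 : c 2 = 1 / 2) (t : ℝ) :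
    ∑ m ∈ Finset.range (N + 1), (c m : ℂ) * (t * I) ^ m =
      -(t ^ 2 / 2) + ∑ m : Finset.Icc 3 N, (c m : ℂ) * (t * I) ^ (m : ℕ) := by
  rw [Finset.sum_coe_sort (Finset.Icc 3 N) fun m => (c m : ℂ) * (t * I) ^ m,
    Finset.range_eq_Ico, ← Finset.sum_Ico_consecutive _ (Nat.zero_le 3) (by omega)]
  congr 1
  simp only [Finset.sum_Ico_eq_sum_range, Finset.sum_range_succ, Finset.sum_range_zero, h0, h1, h2,
    mul_pow]
  push_cast
  norm_num [mul_pow]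
  ring

/-- Comparison of a function with a power-series exponent and its Edgeworth expansion. -/
theorem norm_exp_sub_edgeworth_le {N : ℕ} (hN : 2 ≤ N) {c : ℕ → ℝ} (h0 : c 0 = 0) (h1 : c 1 = 0)
    (h2 : c 2 = 1 / 2) {θ : ℝ} (hθ : 0 < θ) (hc : ∀ m, 3 ≤ m → |c m| ≤ θ ^ (m - 2)) {t : ℝ}
    (ht : t ≠ 0) (hθt : θ * |t| ≤ 1 / 16) {s : ℂ}
    (hs : HasSum (fun m => (c m : ℂ) * (t * I) ^ m) s) :
    ‖cexp s - cexp (-(t ^ 2 / 2)) * (1 + ∑ k ∈ indexSet N, ∏ m : Finset.Icc 3 N,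
        ((c m : ℂ) * (t * I) ^ (m : ℕ)) ^ k m / (k m).factorial)‖ ≤
      (θ * |t|) ^ (N - 1) * ((2 * t ^ 2 + 16 ^ (N - 1)) * Real.exp (-(t ^ 2 / 4))) := by
  have htp : 0 < |t| := abs_pos.mpr ht
  set q := θ * |t| with hq
  have hq0 : 0 < q := by positivity
  set W : ℂ := ∑ m : Finset.Icc 3 N, (c m : ℂ) * (t * I) ^ (m : ℕ) with hW
  set T : ℂ := 1 + ∑ k ∈ indexSet N, ∏ m : Finset.Icc 3 N,
        ((c m : ℂ) * (t * I) ^ (m : ℕ)) ^ k m / (k m).factorial with hT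
  set R : ℂ := ∑' j, (c (j + (N + 1)) : ℂ) * (t * I) ^ (j + (N + 1)) with hR
  have hsum : s = -(t ^ 2 / 2) + W + R := by
    -- The exponent splits into its Gaussian part, the part `W` of degrees `3` to `N`, and the
    -- remainder `R`, which contributes order `q ^ (N - 1)`.
    rw [← hs.tsum_eq, ← hs.summable.sum_add_tsum_nat_add (N + 1),
      sum_range_eq_quadratic_add hN h0 h1 h2]
  have hterm : ∀ m, 3 ≤ m → ‖(c m : ℂ) * (t * I) ^ m‖ ≤ t ^ 2 * q ^ (m - 2) := by
    intro m hm
    rw [norm_mul, norm_pow, norm_mul, Complex.norm_real, Complex.norm_real, Complex.norm_I, mul_one,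
      Real.norm_eq_abs, Real.norm_eq_abs]
    calc |c m| * |t| ^ m ≤ θ ^ (m - 2) * |t| ^ m := by gcongr; exact hc m hm
      _ = t ^ 2 * q ^ (m - 2) := by
        obtain ⟨j, rfl⟩ := Nat.exists_eq_add_of_le (show 2 ≤ m by omega)
        rw [pow_add, sq_abs, hq, mul_pow, Nat.add_sub_cancel_left]
        ring
  have hRn : ‖R‖ ≤ 2 * t ^ 2 * q ^ (N - 1) := by
    have hg := (hasSum_geometric_of_lt_one hq0.le (by linarith : q < 1)).mul_left
      (t ^ 2 * q ^ (N - 1))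
    have := tsum_of_norm_bounded hg (f := fun j => (c (j + (N + 1)) : ℂ) * (t * I) ^ (j + (N + 1)))
      fun j => by
        refine (hterm _ (by omega)).trans_eq ?_
        rw [mul_assoc, ← pow_add]
        congr 2
        omega
    refine this.trans ?_
    have h3 : (1 - q)⁻¹ ≤ 2 := by
      rw [inv_le_comm₀ (by linarith) (by norm_num)]
      linarith
    calc t ^ 2 * q ^ (N - 1) * (1 - q)⁻¹ ≤ t ^ 2 * q ^ (N - 1) * 2 := by gcongr
      _ = _ := by ring
  have hRn' : ‖R‖ ≤ t ^ 2 / 8 := by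
    refine hRn.trans ?_
    have : q ^ (N - 1) ≤ 1 / 16 := by
      calc q ^ (N - 1) ≤ q ^ 1 := pow_le_pow_of_le_one hq0.le (by linarith) (by omega)
        _ ≤ 1 / 16 := by simpa using hθt
    nlinarith [sq_nonneg t]
  -- With this choice `q * ρ = 1/16`. The weighted exponent then stays below `t ^ 2 / 8`, which the
  -- Gaussian factor absorbs, while `ρ⁻¹ ^ (N - 1) = (16 q) ^ (N - 1)` is the desired order.
  set ρ : ℝ := 1 / (16 * q) with hρ
  have hρ1 : 1 ≤ ρ := by
    rw [hρ, le_div_iff₀ (by positivity)]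
    linarith
  have hWρ : ∑ m : Finset.Icc 3 N, ‖(c m : ℂ) * (t * I) ^ (m : ℕ)‖ * ρ ^ ((m : ℕ) - 2) ≤
      t ^ 2 / 8 := by
    calc _ ≤ ∑ m : Finset.Icc 3 N, t ^ 2 * (1 / 16 : ℝ) ^ ((m : ℕ) - 2) := by
          refine Finset.sum_le_sum fun m _ => ?_
          have hm : 3 ≤ (m : ℕ) := (Finset.mem_Icc.mp m.2).1
          calc _ ≤ t ^ 2 * q ^ ((m : ℕ) - 2) * ρ ^ ((m : ℕ) - 2) := by
                gcongr
                exact hterm m hm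
            _ = _ := by
                rw [mul_assoc, ← mul_pow]
                congr 2
                rw [hρ]
                field_simp
      _ ≤ t ^ 2 * (1 / 8) := by
          rw [← Finset.mul_sum]
          gcongr
          exact sum_Icc_pow_le N
      _ = _ := by ring
  have hWn : ‖W‖ ≤ t ^ 2 / 8 := by
    refine (norm_sum_le _ _).trans (le_trans (Finset.sum_le_sum fun m _ => ?_) hWρ)
    exact le_mul_of_one_le_right (norm_nonneg _) (one_le_pow₀ hρ1)
  have hA : ‖cexp W - T‖ ≤ (16 * q) ^ (N - 1) * Real.exp (t ^ 2 / 4) := by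
    refine (norm_exp_sum_sub_trunc_le hN _ hρ1).trans ?_
    rw [hρ, one_div, inv_inv]
    gcongr
    rw [hρ, one_div] at hWρ
    refine hWρ.trans ?_
    nlinarith [sq_nonneg t]
  have hB : ‖cexp (W + R) - cexp W‖ ≤ 2 * t ^ 2 * q ^ (N - 1) * Real.exp (t ^ 2 / 4) := by
    have e : cexp (W + R) - cexp W = cexp W * (cexp R - 1) := by rw [Complex.exp_add]; ring
    have h3 : ‖cexp R - 1‖ ≤ ‖R‖ * Real.exp ‖R‖ := by
      simpa using Complex.norm_exp_sub_sum_le_norm_mul_exp R 1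
    have h4 : ‖cexp W‖ ≤ Real.exp ‖W‖ := Complex.norm_exp_le_exp_norm W
    rw [e, norm_mul]
    calc _ ≤ Real.exp (t ^ 2 / 8) * (2 * t ^ 2 * q ^ (N - 1) * Real.exp (t ^ 2 / 8)) := by
          refine mul_le_mul (h4.trans (Real.exp_le_exp.mpr hWn)) (h3.trans ?_) (norm_nonneg _)
            (Real.exp_pos _).le
          gcongr
      _ = 2 * t ^ 2 * q ^ (N - 1) * (Real.exp (t ^ 2 / 8) * Real.exp (t ^ 2 / 8)) := by ring
      _ = _ := by
          rw [← Real.exp_add]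
          congr 2
          ring
  have hE : ‖cexp (-(t ^ 2 / 2))‖ = Real.exp (-(t ^ 2 / 2)) := by
    rw [Complex.norm_exp]
    congr 1
    have : (-((t : ℂ) ^ 2 / 2)) = ((-(t ^ 2 / 2) : ℝ) : ℂ) := by push_cast; ring
    rw [this, Complex.ofReal_re]
  have e : cexp s - cexp (-(t ^ 2 / 2)) * T =
      cexp (-(t ^ 2 / 2)) * ((cexp (W + R) - cexp W) + (cexp W - T)) := by
    rw [hsum, add_assoc, Complex.exp_add]
    ring
  rw [e, norm_mul, hE]
  calc _ ≤ Real.exp (-(t ^ 2 / 2)) * (2 * t ^ 2 * q ^ (N - 1) * Real.exp (t ^ 2 / 4) +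
        (16 * q) ^ (N - 1) * Real.exp (t ^ 2 / 4)) := by
        gcongr
        exact (norm_add_le _ _).trans (add_le_add hB hA)
    _ = q ^ (N - 1) * ((2 * t ^ 2 + 16 ^ (N - 1)) *
        (Real.exp (-(t ^ 2 / 2)) * Real.exp (t ^ 2 / 4))) := by
        rw [mul_pow]
        ring
    _ = _ := by
        rw [← Real.exp_add]
        congr 3
        ring

end Truncation

end GammaTail

namespace GammaTail

/-! ### The Edgeworth expansion from bounds on the characteristic function -/

section EdgeworthBound

open Complex

/-- The dominating function in the comparison of characteristic functions. -/
noncomputable def edgeworthMajorant (N : ℕ) (d t : ℝ) : ℝ :=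
  |t| ^ (N - 2) * ((2 * t ^ 2 + 16 ^ (N - 1)) * Real.exp (-(t ^ 2 / 4)) +
    16 ^ (N - 1) * (((1 + d * t ^ 2) ^ (N + 1))⁻¹ + Real.exp (-(t ^ 2 / 2)) *
      (1 + ∑ k ∈ indexSet N, |t| ^ (∑ m : Finset.Icc 3 N, (m : ℕ) * k m))))

theorem integrable_abs_pow_mul_exp (n : ℕ) {b : ℝ} (hb : 0 < b) :
    Integrable fun t : ℝ => |t| ^ n * Real.exp (-(t ^ 2 / b)) := by
  have h := (integrable_rpow_mul_exp_neg_mul_sq (b := 1 / b) (by positivity) (s := n)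
    (by linarith [(Nat.cast_nonneg n : (0 : ℝ) ≤ n)])).norm
  refine h.congr (ae_of_all _ fun t => ?_)
  simp only [Real.rpow_natCast, norm_mul, norm_pow, Real.norm_eq_abs, Real.abs_exp]
  congr 2
  ring

theorem integrable_abs_pow_mul_inv (N : ℕ) {d : ℝ} (hd : 0 < d) :
    Integrable fun t : ℝ => |t| ^ (N - 2) * ((1 + d * t ^ 2) ^ (N + 1))⁻¹ := by
  -- Chosen so that `1 + d t ^ 2 ≥ e (1 + t ^ 2)`. The exponent `N + 1` then leaves one spare factor
  -- `(1 + t ^ 2)⁻¹`, which is integrable.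
  set e := min d 1 with he
  have he0 : 0 < e := lt_min hd one_pos
  refine (integrable_inv_one_add_sq.const_mul ((e ^ (N + 1))⁻¹)).mono ?_ (ae_of_all _ fun t => ?_)
  · refine Continuous.aestronglyMeasurable (Continuous.mul (by fun_prop) (Continuous.inv₀ (by fun_prop) ?_))
    intro t
    positivity
  · have hp : 0 < 1 + t ^ 2 := by positivity
    rw [Real.norm_of_nonneg (by positivity), Real.norm_of_nonneg (by positivity)]
    have h1 : e * (1 + t ^ 2) ≤ 1 + d * t ^ 2 := by
      have := min_le_left d 1
      have := min_le_right d 1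
      nlinarith [sq_nonneg t]
    have h2 : |t| ≤ 1 + t ^ 2 := by nlinarith [sq_abs t, sq_nonneg (|t| - 1)]
    have h3 : |t| ^ (N - 2) ≤ (1 + t ^ 2) ^ N :=
      (pow_le_pow_left₀ (abs_nonneg t) h2 _).trans
        (pow_le_pow_right₀ (by nlinarith [sq_nonneg t]) (by omega))
    calc |t| ^ (N - 2) * ((1 + d * t ^ 2) ^ (N + 1))⁻¹
        ≤ (1 + t ^ 2) ^ N * ((e * (1 + t ^ 2)) ^ (N + 1))⁻¹ := by gcongr
      _ = (e ^ (N + 1))⁻¹ * (1 + t ^ 2)⁻¹ := by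
        rw [mul_pow, pow_succ (1 + t ^ 2)]
        field_simp

theorem integrable_edgeworthMajorant (N : ℕ) {d : ℝ} (hd : 0 < d) :
    Integrable (edgeworthMajorant N d) := by
  have h1 := ((integrable_abs_pow_mul_exp (N - 2 + 2) (b := 4) (by norm_num)).const_mul 2).add
    ((integrable_abs_pow_mul_exp (N - 2) (b := 4) (by norm_num)).const_mul (16 ^ (N - 1)))
  have h2 := (integrable_abs_pow_mul_inv N hd).const_mul (16 ^ (N - 1))
  have h3 := ((integrable_abs_pow_mul_exp (N - 2) (b := 2) (by norm_num)).add
    (integrable_finsetSum (indexSet N) fun k _ => integrable_abs_pow_mul_exp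
      (N - 2 + ∑ m : Finset.Icc 3 N, (m : ℕ) * k m) (b := 2) (by norm_num))).const_mul (16 ^ (N - 1))
  refine ((h1.add h2).add h3).congr (ae_of_all _ fun t => ?_)
  simp only [Pi.add_apply, edgeworthMajorant, pow_add, sq_abs, ← Finset.sum_mul, ← Finset.mul_sum]
  ring

theorem norm_edgeworth_transform_le {N : ℕ} {c : ℕ → ℝ} (hc : ∀ m, 3 ≤ m → |c m| ≤ 1) (t : ℝ) :
    ‖cexp (-(t ^ 2 / 2)) * (1 + ∑ k ∈ indexSet N, ∏ m : Finset.Icc 3 N,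
        ((c m : ℂ) * (t * I) ^ (m : ℕ)) ^ k m / (k m).factorial)‖ ≤
      Real.exp (-(t ^ 2 / 2)) *
        (1 + ∑ k ∈ indexSet N, |t| ^ (∑ m : Finset.Icc 3 N, (m : ℕ) * k m)) := by
  have hE : ‖cexp (-(t ^ 2 / 2))‖ = Real.exp (-(t ^ 2 / 2)) := by
    rw [Complex.norm_exp]
    congr 1
    have : (-((t : ℂ) ^ 2 / 2)) = ((-(t ^ 2 / 2) : ℝ) : ℂ) := by push_cast; ring
    rw [this, Complex.ofReal_re]
  rw [norm_mul, hE]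
  gcongr
  refine (norm_add_le _ _).trans ?_
  rw [norm_one]
  gcongr
  refine norm_sum_le_of_le _ fun k _ => ?_
  rw [norm_prod, ← Finset.prod_pow_eq_pow_sum]
  refine Finset.prod_le_prod (fun m _ => norm_nonneg _) fun m _ => ?_
  have hm : 3 ≤ (m : ℕ) := (Finset.mem_Icc.mp m.2).1
  rw [norm_div, norm_pow, norm_mul, norm_pow, norm_mul, Complex.norm_real, Complex.norm_real,
    Complex.norm_I, mul_one, Real.norm_eq_abs, Real.norm_eq_abs, Complex.norm_natCast, pow_mul]
  have h1 : (1 : ℝ) ≤ (k m).factorial := by exact_mod_cast Nat.factorial_pos _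
  calc _ ≤ (|c m| * |t| ^ (m : ℕ)) ^ k m := div_le_self (by positivity) h1
    _ ≤ (1 * |t| ^ (m : ℕ)) ^ k m := by
      gcongr
      exact hc m hm
    _ = _ := by rw [one_mul]

/-- Edgeworth expansion for a law whose characteristic function has a convergent logarithm near the
origin and decays polynomially. -/
theorem abs_measure_Iic_sub_edgeworth_le {N : ℕ} (hN : 2 ≤ N) {d : ℝ} (hd : 0 < d)
    {μ : Measure ℝ} [IsProbabilityMeasure μ] {κ : ℕ → ℝ} {c : ℕ → ℝ}
    (hκ : ∀ m, 3 ≤ m → κ m / m.factorial = c m)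
    (h0 : c 0 = 0) (h1 : c 1 = 0) (h2 : c 2 = 1 / 2) {θ : ℝ} (hθ : 0 < θ) (hθ1 : θ ≤ 1)
    (hc : ∀ m, 3 ≤ m → |c m| ≤ θ ^ (m - 2))
    (hnear : ∀ t, θ * |t| ≤ 1 / 16 →
      ∃ s, HasSum (fun m => (c m : ℂ) * (t * I) ^ m) s ∧ charFun μ t = cexp s)
    (hfar : ∀ t, ‖charFun μ t‖ ≤ ((1 + d * t ^ 2) ^ (N + 1))⁻¹) (x : ℝ) :
    |μ.real (Set.Iic x) - edgeworth N κ x| ≤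
      (Real.pi⁻¹ * ∫ t, edgeworthMajorant N d t) * θ ^ (N - 1) := by
  have hB := (integrable_edgeworthMajorant N hd).const_mul (θ ^ (N - 1))
  have := abs_measure_Iic_sub_le (μ := μ) (integrable_edgeworthDensity N κ) hB ?_ x
  · rw [integral_Iic_edgeworthDensity, integral_const_mul] at this
    refine this.trans_eq ?_
    ring
  intro t ht
  have htp : 0 < |t| := abs_pos.mpr ht
  rw [integral_exp_mul_edgeworthDensity]
  have e : ∀ k : Finset.Icc 3 N → ℕ, ∏ m : Finset.Icc 3 N,
      ((κ m / (m : ℕ).factorial : ℝ) * (t * I : ℂ) ^ (m : ℕ)) ^ k m / (k m).factorial =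
      ∏ m : Finset.Icc 3 N, ((c m : ℂ) * (t * I) ^ (m : ℕ)) ^ k m / (k m).factorial := by
    intro k
    refine Finset.prod_congr rfl fun m _ => ?_
    rw [hκ m (Finset.mem_Icc.mp m.2).1]
  simp_rw [e]
  -- The first summand serves the frequencies with `θ |t| ≤ 1/16` and the second the others. The
  -- power `|t| ^ (N - 2)` in the majorant is `|t| ^ (N - 1)` with one factor given to the smoothing
  -- inequality.
  have e2 : θ ^ (N - 1) * edgeworthMajorant N d t * |t| = (θ * |t|) ^ (N - 1) *
      ((2 * t ^ 2 + 16 ^ (N - 1)) * Real.exp (-(t ^ 2 / 4))) + (16 * (θ * |t|)) ^ (N - 1) *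
      (((1 + d * t ^ 2) ^ (N + 1))⁻¹ + Real.exp (-(t ^ 2 / 2)) *
      (1 + ∑ k ∈ indexSet N, |t| ^ (∑ m : Finset.Icc 3 N, (m : ℕ) * k m))) := by
    obtain ⟨j, rfl⟩ := Nat.exists_eq_add_of_le hN
    rw [edgeworthMajorant, show 2 + j - 1 = j + 1 by omega, show 2 + j - 2 = j by omega,
      mul_pow, mul_pow, mul_pow]
    ring
  have hS : 0 ≤ ∑ k ∈ indexSet N, |t| ^ (∑ m : Finset.Icc 3 N, (m : ℕ) * k m) :=
    Finset.sum_nonneg fun _ _ => by positivity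
  rw [e2]
  rcases le_or_gt (θ * |t|) (1 / 16) with hsmall | hlarge
  · obtain ⟨s, hs, hsφ⟩ := hnear t hsmall
    rw [hsφ]
    refine (norm_exp_sub_edgeworth_le hN h0 h1 h2 hθ hc ht hsmall hs).trans ?_
    refine le_add_of_nonneg_right ?_
    positivity
  · have h16 : 1 ≤ (16 * (θ * |t|)) ^ (N - 1) := one_le_pow₀ (by linarith)
    have hc1 : ∀ m, 3 ≤ m → |c m| ≤ 1 := fun m hm => (hc m hm).trans (pow_le_one₀ hθ.le hθ1)
    refine (norm_sub_le _ _).trans ((add_le_add (hfar t) (norm_edgeworth_transform_le hc1 t)).trans ?_)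
    refine le_add_of_nonneg_of_le (by positivity) (le_mul_of_one_le_left (by positivity) h16)

end EdgeworthBound

end GammaTail

namespace GammaTail

/-! ### The centred gamma law -/

section CenteredGamma

open Complex

/-- The logarithm of the moment generating function of the centred gamma law of shape and rate
`r`. -/
noncomputable def gammaExponent (r : ℝ) (z : ℂ) : ℂ :=
  -(r * Complex.log (1 - z / r)) - z

/-- The coefficients of the power series of `gammaExponent`. -/
noncomputable def gammaCoeff (r : ℝ) (m : ℕ) : ℝ :=
  if m < 2 then 0 else (r ^ (m - 1) * m)⁻¹

theorem gammaCoeff_nonneg {r : ℝ} (hr : 0 < r) (m : ℕ) : 0 ≤ gammaCoeff r m := by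
  rw [gammaCoeff]
  split_ifs <;> positivity

theorem hasSum_gammaExponent {r : ℝ} (hr : 0 < r) {z : ℂ} (hz : ‖z‖ < r) :
    HasSum (fun m => (gammaCoeff r m : ℂ) * z ^ m) (gammaExponent r z) := by
  have hr' : (r : ℂ) ≠ 0 := by exact_mod_cast hr.ne'
  have h1 : ‖z / r‖ < 1 := by
    rw [norm_div, Complex.norm_real, Real.norm_of_nonneg hr.le, div_lt_one hr]
    exact hz
  have h2 := (Complex.hasSum_taylorSeries_neg_log h1).mul_left (r : ℂ)
  have h3 : HasSum (fun m : ℕ => if m = 1 then z else 0) z := hasSum_ite_eq 1 z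
  have h4 := h2.sub h3
  have e : (r : ℂ) * -Complex.log (1 - z / r) - z = gammaExponent r z := by
    rw [gammaExponent]
    ring
  rw [e] at h4
  refine h4.congr_fun fun m => ?_
  rcases m with _ | _ | m
  · simp [gammaCoeff]
  · simp [gammaCoeff, mul_div_cancel₀ _ hr']
  · have h5 : ¬ m + 1 + 1 < 2 := by omega
    have h6 : m + 1 + 1 ≠ 1 := by omega
    rw [gammaCoeff, if_neg h5, if_neg h6, Nat.add_sub_cancel, sub_zero, div_pow, pow_succ (r : ℂ)]
    have h7 : ((m + 1 + 1 : ℕ) : ℂ) ≠ 0 := Nat.cast_ne_zero.mpr (Nat.succ_ne_zero (m + 1))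
    push_cast at h7 ⊢
    field_simp

/-- Centring cancels the linear term of the logarithm. The quadratic bound is why square summability
of the weights suffices. -/
theorem norm_gammaExponent_le {r : ℝ} (hr : 0 < r) {z : ℂ} (hz : ‖z‖ ≤ r / 2) :
    ‖gammaExponent r z‖ ≤ ‖z‖ ^ 2 / r := by
  have hr' : (r : ℂ) ≠ 0 := by exact_mod_cast hr.ne'
  have hn : ‖-(z / r)‖ = ‖z‖ / r := by
    rw [norm_neg, norm_div, Complex.norm_real, Real.norm_of_nonneg hr.le]
  have h1 : ‖z‖ / r ≤ 1 / 2 := by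
    rw [div_le_iff₀ hr]
    linarith
  have h2 := Complex.norm_log_one_add_sub_self_le (z := -(z / r)) (by rw [hn]; linarith)
  rw [hn] at h2
  have e : gammaExponent r z = -(r * (Complex.log (1 + -(z / r)) - -(z / r))) := by
    rw [gammaExponent, ← sub_eq_add_neg]
    field_simp
    ring
  rw [e, norm_neg, norm_mul, Complex.norm_real, Real.norm_of_nonneg hr.le]
  have h3 : (1 - ‖z‖ / r)⁻¹ ≤ 2 := by
    rw [inv_le_comm₀ (by linarith) (by norm_num)]
    linarith
  calc r * ‖Complex.log (1 + -(z / r)) - -(z / r)‖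
      ≤ r * ((‖z‖ / r) ^ 2 * 2 / 2) := by
        refine mul_le_mul_of_nonneg_left (h2.trans ?_) hr.le
        gcongr
    _ = ‖z‖ ^ 2 / r := by field_simp

theorem one_sub_div_mem_slitPlane {r : ℝ} (hr : 0 < r) {z : ℂ} (hz : z.re < r) :
    1 - z / r ∈ slitPlane := by
  refine Or.inl ?_
  rw [sub_re, one_re, div_ofReal_re, sub_pos, div_lt_one hr]
  exact hz

theorem integral_exp_mul_gammaMeasure {r : ℝ} (hr : 0 < r) {t : ℝ} (ht : t < r) :
    ∫ x, Real.exp (t * x) ∂(gammaMeasure r r) = Real.exp (-(r * Real.log (1 - t / r))) := by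
  have h1 : 0 < 1 - t / r := by
    rw [sub_pos, div_lt_one hr]
    exact ht
  rw [gammaMeasure, integral_withDensity_eq_integral_toReal_smul (f := gammaPDF r r)
    (measurable_gammaPDFReal r r).ennreal_ofReal
    (ae_of_all _ fun x => ENNReal.ofReal_lt_top)]
  have e : ∀ x : ℝ, (gammaPDF r r x).toReal • Real.exp (t * x) =
      (Set.Ici (0 : ℝ)).indicator (fun x => r ^ r / Real.Gamma r *
        (x ^ (r - 1) * Real.exp (-((r - t) * x)))) x := by
    intro x
    rw [gammaPDF, ENNReal.toReal_ofReal (gammaPDFReal_nonneg hr hr x), gammaPDFReal]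
    by_cases hx : 0 ≤ x
    · rw [if_pos hx, Set.indicator_of_mem (Set.mem_Ici.mpr hx), smul_eq_mul, mul_assoc, mul_assoc,
        ← Real.exp_add]
      ring_nf
    · rw [if_neg hx, Set.indicator_of_notMem (by simpa using hx), zero_smul]
  simp_rw [e]
  rw [integral_indicator measurableSet_Ici, integral_Ici_eq_integral_Ioi, integral_const_mul,
    Real.integral_rpow_mul_exp_neg_mul_Ioi hr (sub_pos.mpr ht)]
  have h2 : Real.Gamma r ≠ 0 := (Real.Gamma_pos_of_pos hr).ne'
  have h3 : Real.exp (-(r * Real.log (1 - t / r))) = (1 - t / r) ^ (-r) := by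
    rw [Real.rpow_def_of_pos h1]
    congr 1
    ring
  have h4 : 1 - t / r = (r - t) / r := by field_simp
  have h5 : 0 < r - t := sub_pos.mpr ht
  rw [h3, h4, Real.rpow_neg (by positivity), Real.div_rpow h5.le hr.le, one_div,
    Real.inv_rpow h5.le]
  field_simp

theorem integrable_exp_mul_gammaMeasure {r : ℝ} (hr : 0 < r) {t : ℝ} (ht : t < r) :
    Integrable (fun x => Real.exp (t * x)) (gammaMeasure r r) :=
  -- A function that is not integrable has Bochner integral zero by convention, so a nonzero value
  -- proves integrability.
  Integrable.of_integral_ne_zero (by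
    rw [integral_exp_mul_gammaMeasure hr ht]
    exact (Real.exp_pos _).ne')

/-- Both sides are analytic on the half-plane `re z < r` and agree on the real axis, where the
integral is a Gamma integral. The identity theorem gives the rest. -/
theorem complexMGF_gammaMeasure {r : ℝ} (hr : 0 < r) {z : ℂ} (hz : z.re < r) :
    complexMGF id (gammaMeasure r r) z = cexp (-(r * Complex.log (1 - z / r))) := by
  have hset : ∀ w : ℂ, w.re < r → w.re ∈ interior (integrableExpSet id (gammaMeasure r r)) := by
    intro w hw
    have : Set.Iio r ⊆ integrableExpSet id (gammaMeasure r r) := fun t ht =>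
      integrable_exp_mul_gammaMeasure hr ht
    exact interior_mono this (by rw [isOpen_Iio.interior_eq]; exact hw)
  have hU : IsPreconnected {w : ℂ | w.re < r} := (convex_halfSpace_re_lt r).isPreconnected
  have hf : AnalyticOnNhd ℂ (complexMGF id (gammaMeasure r r)) {w : ℂ | w.re < r} := fun w hw =>
    analyticAt_complexMGF (hset w hw)
  have hg : AnalyticOnNhd ℂ (fun w : ℂ => cexp (-(r * Complex.log (1 - w / r))))
      {w : ℂ | w.re < r} := fun w hw => by
    have := one_sub_div_mem_slitPlane hr hw
    fun_prop (disch := assumption)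
  refine hf.eqOn_of_preconnected_of_frequently_eq hg hU (z₀ := 0) (by simpa using hr) ?_ hz
  have hreal : ∀ t : ℝ, t < r → complexMGF id (gammaMeasure r r) t =
      cexp (-(r * Complex.log (1 - t / r))) := by
    intro t ht
    have h1 : 0 < 1 - t / r := by
      rw [sub_pos, div_lt_one hr]
      exact ht
    rw [complexMGF_ofReal, mgf]
    simp only [id]
    rw [integral_exp_mul_gammaMeasure hr ht, Complex.ofReal_exp]
    push_cast [Complex.ofReal_log h1.le]
    rfl
  -- Negative points stay to the left of `r`, however small `r` is.
  have ht : Tendsto (fun n : ℕ => ((-(1 / ((n : ℝ) + 1)) : ℝ) : ℂ)) atTop (𝓝[≠] 0) := by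
    refine tendsto_nhdsWithin_iff.mpr ⟨?_, Eventually.of_forall fun n => ?_⟩
    · have := (tendsto_one_div_add_atTop_nhds_zero_nat (𝕜 := ℝ)).neg
      rw [neg_zero] at this
      exact_mod_cast (Complex.continuous_ofReal.tendsto 0).comp this
    · have : -(1 / ((n : ℝ) + 1)) ≠ 0 := by
        have : 0 < 1 / ((n : ℝ) + 1) := by positivity
        linarith
      exact Complex.ofReal_ne_zero.mpr this
  refine ht.frequently (Eventually.of_forall fun n => hreal _ ?_).frequently
  have : 0 < 1 / ((n : ℝ) + 1) := by positivity
  linarith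

variable {Ω : Type*} [MeasurableSpace Ω]

/-- `X` has the law of `η - 1` where `η` is a gamma variable of shape and rate `r`, expressed
through its complex moment generating function. -/
structure IsCenteredGamma (r : ℝ) (X : Ω → ℝ) (P : Measure Ω) : Prop where
  aemeasurable : AEMeasurable X P
  integrable_exp : ∀ t < r, Integrable (fun ω => Real.exp (t * X ω)) P
  complexMGF_eq : ∀ z : ℂ, z.re < r → complexMGF X P z = cexp (gammaExponent r z)

theorem isCenteredGamma_sub_one {r : ℝ} (hr : 0 < r) {P : Measure Ω} {η : Ω → ℝ}
    (hη : HasLaw η (gammaMeasure r r) P) : IsCenteredGamma r (fun ω => η ω - 1) P where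
  aemeasurable := hη.aemeasurable.sub_const 1
  integrable_exp t ht := by
    have h := (integrable_map_measure (f := η) (μ := P) (g := fun x => Real.exp (t * x))
      (Continuous.aestronglyMeasurable (by fun_prop)) hη.aemeasurable).mp (by
        rw [hη.map_eq]
        exact integrable_exp_mul_gammaMeasure hr ht)
    refine (h.mul_const (Real.exp (-t))).congr (ae_of_all _ fun ω => ?_)
    simp only [Function.comp_apply]
    rw [← Real.exp_add]
    ring_nf
  complexMGF_eq z hz := by
    have h := complexMGF_gammaMeasure hr hz
    rw [← hη.map_eq, complexMGF_id_map hη.aemeasurable] at h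
    rw [gammaExponent, sub_eq_add_neg, Complex.exp_add, ← h, complexMGF, complexMGF,
      ← integral_mul_const]
    congr 1 with ω
    rw [← Complex.exp_add]
    push_cast
    ring_nf

variable {P : Measure Ω} {r : ℝ} {X : Ω → ℝ}

theorem IsCenteredGamma.mgf_le (hX : IsCenteredGamma r X P) (hr : 0 < r) {t : ℝ}
    (ht : |t| ≤ r / 2) : mgf X P t ≤ Real.exp (t ^ 2 / r) := by
  have h1 : (t : ℂ).re < r := by
    rw [ofReal_re]
    linarith [le_abs_self t]
  have h2 := hX.complexMGF_eq t h1
  rw [complexMGF_ofReal] at h2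
  calc mgf X P t ≤ ‖(mgf X P t : ℂ)‖ := by
        rw [Complex.norm_real]
        exact le_abs_self _
    _ = ‖cexp (gammaExponent r t)‖ := by rw [h2]
    _ ≤ Real.exp ‖gammaExponent r t‖ := Complex.norm_exp_le_exp_norm _
    _ ≤ Real.exp (t ^ 2 / r) := by
        rw [Real.exp_le_exp]
        refine (norm_gammaExponent_le hr ?_).trans_eq ?_ <;>
        rw [Complex.norm_real, Real.norm_eq_abs]
        · exact ht
        · rw [sq_abs]

theorem IsCenteredGamma.zero_mem_interior (hX : IsCenteredGamma r X P) (hr : 0 < r) :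
    0 ∈ interior (integrableExpSet X P) := by
  have : Set.Iio r ⊆ integrableExpSet X P := fun t ht => hX.integrable_exp t ht
  exact interior_mono this (by rw [isOpen_Iio.interior_eq]; exact hr)

theorem IsCenteredGamma.integrable (hX : IsCenteredGamma r X P) (hr : 0 < r) : Integrable X P :=
  integrable_of_mem_interior_integrableExpSet (hX.zero_mem_interior hr)

theorem IsCenteredGamma.integral_eq_zero (hX : IsCenteredGamma r X P) (hr : 0 < r) :
    ∫ ω, X ω ∂P = 0 := by
  have h0 : (0 : ℂ).re ∈ interior (integrableExpSet X P) := by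
    simpa using hX.zero_mem_interior hr
  have h1 := hasDerivAt_complexMGF h0
  have hr' : (r : ℂ) ≠ 0 := by exact_mod_cast hr.ne'
  have h2 : HasDerivAt (fun z => cexp (gammaExponent r z)) 0 0 := by
    have hs := one_sub_div_mem_slitPlane hr (z := 0) (by simpa using hr)
    have h3 : HasDerivAt (fun z : ℂ => 1 - z / r) (-(1 / r)) 0 := by
      simpa using ((hasDerivAt_id (0 : ℂ)).div_const (r : ℂ)).const_sub 1
    have h4 := ((((h3.clog hs).const_mul (r : ℂ)).neg).sub (hasDerivAt_id (0 : ℂ))).cexp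
    refine h4.congr_deriv ?_
    simp [hr']
  have h3 : complexMGF X P =ᶠ[𝓝 0] fun z => cexp (gammaExponent r z) := by
    have : ∀ᶠ z : ℂ in 𝓝 0, z.re < r := Complex.continuous_re.tendsto' 0 0 (by simp) |>.eventually_lt_const hr
    filter_upwards [this] with z hz
    exact hX.complexMGF_eq z hz
  have h4 := h1.unique (h2.congr_of_eventuallyEq h3)
  simp only [zero_mul, Complex.exp_zero, mul_one] at h4
  rw [integral_complex_ofReal] at h4
  exact_mod_cast h4

theorem IsCenteredGamma.charFun_const_mul (hX : IsCenteredGamma r X P) (hr : 0 < r) (b t : ℝ) :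
    charFun (P.map fun ω => b * X ω) t = cexp (gammaExponent r (b * (t * I))) := by
  rw [charFun_map_mul_comp hX.aemeasurable, ← complexMGF_mul_I hX.aemeasurable,
    hX.complexMGF_eq _ (by simpa using hr)]
  push_cast
  ring_nf

/-- The decay exponent `r` of one factor can be too small for integrability. Many factors have to be
multiplied, which `norm_charFun_limit_le` does. -/
theorem norm_exp_gammaExponent_mul_I (hr : 0 < r) (s : ℝ) :
    ‖cexp (gammaExponent r (s * I))‖ = (1 + s ^ 2 / r ^ 2) ^ (-(r / 2)) := by
  have h1 : 0 < 1 + s ^ 2 / r ^ 2 := by positivity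
  have hn : ‖1 - (s * I : ℂ) / r‖ = Real.sqrt (1 + s ^ 2 / r ^ 2) := by
    have : (1 - (s * I : ℂ) / r) = ((1 : ℝ) : ℂ) + ((-(s / r) : ℝ) : ℂ) * I := by
      push_cast
      ring
    rw [this, Complex.norm_add_mul_I]
    congr 1
    ring
  rw [gammaExponent, Complex.norm_exp]
  have : (-(r * Complex.log (1 - s * I / r)) - s * I).re = -(r * Real.log ‖1 - (s * I : ℂ) / r‖) := by
    simp [Complex.log_re]
  rw [this, hn, Real.log_sqrt h1.le, Real.rpow_def_of_pos h1]
  congr 1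
  ring

end CenteredGamma

end GammaTail

namespace GammaTail

/-! ### Series of independent centred gamma variables -/

section Series

open Complex

variable {Ω : Type*} [MeasurableSpace Ω] {P : Measure Ω} {r B : ℝ}
  {ξ : ℕ → Ω → ℝ} {b : ℕ → ℝ}

theorem abs_mul_le_half (hb0 : ∀ j, 0 ≤ b j) (hbB : ∀ j, b j ≤ B) {t : ℝ}
    (ht : |t| * B ≤ r / 2) (j : ℕ) : |b j * t| ≤ r / 2 := by
  rw [abs_mul, abs_of_nonneg (hb0 j), mul_comm]
  exact (mul_le_mul_of_nonneg_left (hbB j) (abs_nonneg t)).trans ht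

theorem mgf_partialSum (hξ : ∀ j, IsCenteredGamma r (ξ j) P) (hind : iIndepFun ξ P) (K : ℕ)
    (t : ℝ) : mgf (fun ω => ∑ j ∈ Finset.range K, b j * ξ j ω) P t =
      ∏ j ∈ Finset.range K, mgf (ξ j) P (b j * t) := by
  have h1 := hind.comp (fun j x => b j * x) fun j => by fun_prop
  have h2 := h1.mgf_sum₀ (t := t) (fun j => (hξ j).aemeasurable.const_mul (b j)) (Finset.range K)
  have e : (∑ j ∈ Finset.range K, (fun x => b j * x) ∘ ξ j) =
      fun ω => ∑ j ∈ Finset.range K, b j * ξ j ω := by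
    ext ω
    simp
  rw [e] at h2
  rw [h2]
  refine Finset.prod_congr rfl fun j _ => ?_
  exact mgf_const_mul (X := ξ j) (b j)

theorem aemeasurable_limit (hξ : ∀ j, IsCenteredGamma r (ξ j) P) {Y : Ω → ℝ}
    (hY : ∀ᵐ ω ∂P, Tendsto (fun K => ∑ j ∈ Finset.range K, b j * ξ j ω) atTop (𝓝 (Y ω))) :
    AEMeasurable Y P :=
  aemeasurable_of_tendsto_metrizable_ae atTop (fun _ =>
    Finset.aemeasurable_fun_sum _ fun j _ => (hξ j).aemeasurable.const_mul _) hY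

theorem charFun_partialSum (hr : 0 < r) (hξ : ∀ j, IsCenteredGamma r (ξ j) P)
    (hind : iIndepFun ξ P) (K : ℕ) (t : ℝ) :
    charFun (P.map fun ω => ∑ j ∈ Finset.range K, b j * ξ j ω) t =
      ∏ j ∈ Finset.range K, cexp (gammaExponent r (b j * (t * I))) := by
  have h1 := (hind.comp (fun j x => b j * x) fun j => by fun_prop).precomp
    (g := fun i : Fin K => (i : ℕ)) Fin.val_injective
  have h2 := h1.charFun_map_sum_eq_prod fun i : Fin K =>
    (show AEMeasurable ((fun x => b i * x) ∘ ξ i) P from (hξ i).aemeasurable.const_mul (b i))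
  have e : (∑ i : Fin K, (fun x => b i * x) ∘ ξ i) =
      fun ω => ∑ j ∈ Finset.range K, b j * ξ j ω := by
    ext ω
    simp [Finset.sum_range]
  rw [e] at h2
  rw [h2, Finset.prod_apply, Finset.prod_range]
  refine Finset.prod_congr rfl fun i _ => ?_
  exact (hξ i).charFun_const_mul hr (b i) t

theorem mgf_partialSum_le (hr : 0 < r) (hξ : ∀ j, IsCenteredGamma r (ξ j) P)
    (hind : iIndepFun ξ P) (hb0 : ∀ j, 0 ≤ b j) (hbB : ∀ j, b j ≤ B)
    (hb2 : Summable fun j => b j ^ 2) (K : ℕ) {t : ℝ} (ht : |t| * B ≤ r / 2) :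
    mgf (fun ω => ∑ j ∈ Finset.range K, b j * ξ j ω) P t ≤
      Real.exp (t ^ 2 / r * ∑' j, b j ^ 2) := by
  rw [mgf_partialSum hξ hind]
  calc _ ≤ ∏ j ∈ Finset.range K, Real.exp (t ^ 2 / r * b j ^ 2) := by
        refine Finset.prod_le_prod (fun j _ => mgf_nonneg) fun j _ => ?_
        refine ((hξ j).mgf_le hr (abs_mul_le_half hb0 hbB ht j)).trans_eq ?_
        congr 1
        ring
    _ = Real.exp (t ^ 2 / r * ∑ j ∈ Finset.range K, b j ^ 2) := by
        rw [← Real.exp_sum, Finset.mul_sum]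
    _ ≤ _ := by
        gcongr
        exact hb2.sum_le_tsum _ fun j _ => sq_nonneg _

variable [IsProbabilityMeasure P]

theorem integrable_exp_partialSum (hr : 0 < r) (hξ : ∀ j, IsCenteredGamma r (ξ j) P)
    (hind : iIndepFun ξ P) (hb0 : ∀ j, 0 ≤ b j) (hbB : ∀ j, b j ≤ B) (K : ℕ) {t : ℝ}
    (ht : |t| * B ≤ r / 2) :
    Integrable (fun ω => Real.exp (t * ∑ j ∈ Finset.range K, b j * ξ j ω)) P := by
  refine Integrable.of_integral_ne_zero ?_
  have := mgf_partialSum (b := b) hξ hind K t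
  rw [mgf] at this
  rw [this]
  refine Finset.prod_ne_zero_iff.mpr fun j _ => (mgf_pos ((hξ j).integrable_exp _ ?_)).ne'
  have := abs_mul_le_half hb0 hbB ht j
  linarith [le_abs_self (b j * t)]

/-- From `t |x| ≤ exp (t x) + exp (-t x)` at `t = r / (2 B)`, the largest parameter at which the
exponential moment bound holds. Uniformity in `K` gives the `L¹` bound for martingale convergence.
-/
theorem integral_abs_partialSum_le (hr : 0 < r) (hB : 0 < B)
    (hξ : ∀ j, IsCenteredGamma r (ξ j) P)
    (hind : iIndepFun ξ P) (hb0 : ∀ j, 0 ≤ b j) (hbB : ∀ j, b j ≤ B)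
    (hb2 : Summable fun j => b j ^ 2) (K : ℕ) :
    ∫ ω, |∑ j ∈ Finset.range K, b j * ξ j ω| ∂P ≤
      (r / (2 * B))⁻¹ * (2 * Real.exp ((r / (2 * B)) ^ 2 / r * ∑' j, b j ^ 2)) := by
  set t := r / (2 * B) with ht
  have ht0 : 0 < t := by positivity
  have h1 : |t| * B ≤ r / 2 := by
    rw [abs_of_pos ht0, ht]
    apply le_of_eq
    field_simp
  have h2 : |-t| * B ≤ r / 2 := by rwa [abs_neg]
  have i1 := integrable_exp_partialSum hr hξ hind hb0 hbB K h1
  have i2 := integrable_exp_partialSum hr hξ hind hb0 hbB K h2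
  have m1 := mgf_partialSum_le hr hξ hind hb0 hbB hb2 K h1
  have m2 := mgf_partialSum_le hr hξ hind hb0 hbB hb2 K h2
  rw [neg_sq] at m2
  rw [mgf] at m1 m2
  have h3 : ∀ x : ℝ, |x| ≤ t⁻¹ * (Real.exp (t * x) + Real.exp (-t * x)) := by
    intro x
    rw [inv_mul_eq_div, le_div_iff₀ ht0]
    have e1 := Real.add_one_le_exp (t * x)
    have e2 := Real.add_one_le_exp (-t * x)
    have e3 := Real.exp_pos (t * x)
    have e4 := Real.exp_pos (-t * x)
    rcases abs_cases x with ⟨h, _⟩ | ⟨h, _⟩ <;> rw [h] <;> linarith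
  calc _ ≤ ∫ ω, t⁻¹ * (Real.exp (t * ∑ j ∈ Finset.range K, b j * ξ j ω) +
        Real.exp (-t * ∑ j ∈ Finset.range K, b j * ξ j ω)) ∂P := by
        refine integral_mono_of_nonneg (ae_of_all _ fun ω => abs_nonneg _)
          ((i1.add i2).const_mul _) (ae_of_all _ fun ω => h3 _)
    _ ≤ _ := by
        rw [integral_const_mul, integral_add i1 i2, two_mul]
        gcongr

/-- An `L²`-bounded series of independent centred gamma variables converges almost surely. -/
theorem ae_exists_tendsto_partialSum (hr : 0 < r) (hB : 0 < B) (hm : ∀ j, Measurable (ξ j))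
    (hξ : ∀ j, IsCenteredGamma r (ξ j) P)
    (hind : iIndepFun ξ P) (hb0 : ∀ j, 0 ≤ b j) (hbB : ∀ j, b j ≤ B)
    (hb2 : Summable fun j => b j ^ 2) :
    ∀ᵐ ω ∂P, ∃ l, Tendsto (fun K => ∑ j ∈ Finset.range K, b j * ξ j ω) atTop (𝓝 l) := by
  set ℱ := Filtration.natural ξ fun j => (hm j).stronglyMeasurable with hℱ
  -- The shift `K + 1` matches the natural filtration, whose `K`-th member already knows `ξ K`.
  set f : ℕ → Ω → ℝ := fun K ω => ∑ j ∈ Finset.range (K + 1), b j * ξ j ω with hf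
  have hintg : ∀ K, Integrable (f K) P := fun K =>
    integrable_finsetSum _ fun j _ => ((hξ j).integrable hr).const_mul _
  have hadapt : StronglyAdapted ℱ f := by
    intro K
    refine Finset.stronglyMeasurable_fun_sum _ fun j hj => ?_
    refine StronglyMeasurable.const_mul ?_ _
    exact (Filtration.stronglyAdapted_natural (fun j => (hm j).stronglyMeasurable) j).mono
      (ℱ.mono (by simpa [Nat.lt_succ_iff] using hj))
  have hmart : Martingale f ℱ P := by
    refine martingale_nat hadapt hintg fun K => ?_
    have e : f (K + 1) = f K + b (K + 1) • ξ (K + 1) := by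
      ext ω
      simp [hf, Finset.sum_range_succ _ (K + 1)]
    have h1 := condExp_add (hintg K) (((hξ (K + 1)).integrable hr).smul (b (K + 1))) (ℱ K)
    have h2 := condExp_smul (μ := P) (b (K + 1)) (ξ (K + 1)) (ℱ K)
    have h3 := hind.condExp_natural_ae_eq_of_lt (fun j => (hm j).stronglyMeasurable)
      (Nat.lt_succ_self K)
    have h4 := condExp_of_stronglyMeasurable (ℱ.le K) (hadapt K) (hintg K)
    rw [e]
    filter_upwards [h1, h2, h3] with ω h1 h2 h3
    rw [h1, Pi.add_apply, h4, h2, Pi.smul_apply, h3, (hξ (K + 1)).integral_eq_zero hr]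
    simp
  set R : ℝ := (r / (2 * B))⁻¹ * (2 * Real.exp ((r / (2 * B)) ^ 2 / r * ∑' j, b j ^ 2)) with hR
  have hbdd : ∀ K, eLpNorm (f K) 1 P ≤ (R.toNNReal : ENNReal) := by
    intro K
    rw [eLpNorm_one_eq_lintegral_enorm, ← ofReal_integral_norm_eq_lintegral_enorm (hintg K)]
    refine ENNReal.ofReal_le_ofReal ?_
    exact integral_abs_partialSum_le hr hB hξ hind hb0 hbB hb2 (K + 1)
  filter_upwards [hmart.submartingale.exists_ae_tendsto_of_bdd hbdd] with ω ⟨l, hl⟩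
  exact ⟨l, (tendsto_add_atTop_iff_nat 1).mp hl⟩

/-- Fatou's lemma, applied to the exponential moments of the partial sums, which are bounded
uniformly in `K`. -/
theorem integrable_exp_limit (hr : 0 < r) (hξ : ∀ j, IsCenteredGamma r (ξ j) P)
    (hind : iIndepFun ξ P) (hb0 : ∀ j, 0 ≤ b j) (hbB : ∀ j, b j ≤ B)
    (hb2 : Summable fun j => b j ^ 2) {Y : Ω → ℝ}
    (hY : ∀ᵐ ω ∂P, Tendsto (fun K => ∑ j ∈ Finset.range K, b j * ξ j ω) atTop (𝓝 (Y ω)))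
    {t : ℝ} (ht : |t| * B ≤ r / 2) : Integrable (fun ω => Real.exp (t * Y ω)) P := by
  have hTm : ∀ K : ℕ, AEMeasurable (fun ω => ∑ j ∈ Finset.range K, b j * ξ j ω) P := fun K =>
    Finset.aemeasurable_fun_sum _ fun j _ => (hξ j).aemeasurable.const_mul _
  have hYm : AEMeasurable Y P := aemeasurable_of_tendsto_metrizable_ae atTop hTm hY
  refine ⟨(Real.measurable_exp.comp_aemeasurable (hYm.const_mul t)).aestronglyMeasurable, ?_⟩
  rw [hasFiniteIntegral_iff_ofReal (ae_of_all _ fun ω => (Real.exp_pos _).le)]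
  have h1 : ∫⁻ ω, ENNReal.ofReal (Real.exp (t * Y ω)) ∂P = ∫⁻ ω, liminf (fun K : ℕ =>
      ENNReal.ofReal (Real.exp (t * ∑ j ∈ Finset.range K, b j * ξ j ω))) atTop ∂P := by
    refine lintegral_congr_ae ?_
    filter_upwards [hY] with ω hω
    refine (Tendsto.liminf_eq ?_).symm
    exact ENNReal.tendsto_ofReal ((Real.continuous_exp.tendsto _).comp (hω.const_mul t))
  rw [h1]
  refine (lintegral_liminf_le' fun K => ?_).trans_lt ?_
  · exact (Real.measurable_exp.comp_aemeasurable ((hTm K).const_mul t)).ennreal_ofReal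
  · refine (liminf_le_of_frequently_le' (Frequently.of_forall fun K => ?_)).trans_lt
      (ENNReal.ofReal_lt_top (r := Real.exp (t ^ 2 / r * ∑' j, b j ^ 2)))
    rw [← ofReal_integral_eq_lintegral_ofReal (integrable_exp_partialSum hr hξ hind hb0 hbB K ht)
      (ae_of_all _ fun ω => (Real.exp_pos _).le)]
    exact ENNReal.ofReal_le_ofReal (mgf_partialSum_le hr hξ hind hb0 hbB hb2 K ht)

theorem tendsto_charFun_limit (hr : 0 < r) (hξ : ∀ j, IsCenteredGamma r (ξ j) P)
    (hind : iIndepFun ξ P) {Y : Ω → ℝ}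
    (hY : ∀ᵐ ω ∂P, Tendsto (fun K => ∑ j ∈ Finset.range K, b j * ξ j ω) atTop (𝓝 (Y ω)))
    (t : ℝ) :
    Tendsto (fun K => ∏ j ∈ Finset.range K, cexp (gammaExponent r (b j * (t * I)))) atTop
      (𝓝 (charFun (P.map Y) t)) := by
  have hTm : ∀ K : ℕ, AEMeasurable (fun ω => ∑ j ∈ Finset.range K, b j * ξ j ω) P := fun K =>
    Finset.aemeasurable_fun_sum _ fun j _ => (hξ j).aemeasurable.const_mul _
  have hYm := aemeasurable_limit hξ hY
  simp_rw [← charFun_partialSum hr hξ hind, charFun_apply_real]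
  rw [integral_map hYm (Continuous.aestronglyMeasurable (by fun_prop))]
  have e : ∀ K : ℕ, ∫ x, cexp (t * x * I) ∂(P.map fun ω => ∑ j ∈ Finset.range K, b j * ξ j ω) =
      ∫ ω, cexp (t * (∑ j ∈ Finset.range K, b j * ξ j ω : ℝ) * I) ∂P := fun K =>
    integral_map (hTm K) (Continuous.aestronglyMeasurable (by fun_prop))
  simp_rw [e]
  refine tendsto_integral_of_dominated_convergence (fun _ => 1) (fun K => ?_) (integrable_const _)
    (fun K => ae_of_all _ fun ω => ?_) ?_
  · exact (Continuous.measurable (by fun_prop :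
      Continuous fun x : ℝ => cexp (t * x * I))).comp_aemeasurable (hTm K) |>.aestronglyMeasurable
  · rw [← Complex.ofReal_mul, norm_exp_ofReal_mul_I]
  · filter_upwards [hY] with ω hω
    have hc : Continuous fun x : ℝ => cexp (t * x * I) := by fun_prop
    exact (hc.tendsto _).comp hω

/-- The coefficients of the cumulant generating function of the series. -/
noncomputable def seriesCoeff (r : ℝ) (b : ℕ → ℝ) (m : ℕ) : ℝ :=
  gammaCoeff r m * ∑' j, b j ^ m

/-- Two factors of `b j * ‖z‖` are kept and each of the others, divided by `r`, is at most `1/2`.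
This separates `j` from `m`, so the double series converges absolutely and may be summed in either
order. The constant `4` comes from writing `(1/2) ^ m` instead of `(1/2) ^ (m - 2)`. -/
theorem norm_gammaCoeff_mul_le (hr : 0 < r) (hb0 : ∀ j, 0 ≤ b j) (hbB : ∀ j, b j ≤ B) {z : ℂ}
    (hz : ‖z‖ * B ≤ r / 2) (j m : ℕ) :
    ‖(gammaCoeff r m : ℂ) * (b j * z) ^ m‖ ≤ (4 * ‖z‖ ^ 2 / r * b j ^ 2) * (1 / 2) ^ m := by
  have h1 : b j * ‖z‖ ≤ r / 2 := by
    rw [mul_comm]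
    exact (mul_le_mul_of_nonneg_left (hbB j) (norm_nonneg z)).trans hz
  have h0 := hb0 j
  by_cases hm : m < 2
  · rw [gammaCoeff, if_pos hm]
    simp only [ofReal_zero, zero_mul, norm_zero]
    positivity
  · obtain ⟨n, rfl⟩ := Nat.exists_eq_add_of_le (not_lt.mp hm)
    rw [gammaCoeff, if_neg hm, norm_mul, norm_pow, norm_mul, Complex.norm_real, Complex.norm_real,
      Real.norm_of_nonneg h0, Real.norm_of_nonneg (by positivity),
      show 2 + n - 1 = n + 1 by omega]
    have h2 : (b j * ‖z‖ / r) ^ n ≤ (1 / 2) ^ n := by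
      refine pow_le_pow_left₀ (by positivity) ?_ n
      rw [div_le_iff₀ hr]
      linarith
    have h3 : ((2 + n : ℕ) : ℝ)⁻¹ ≤ 1 := by
      refine inv_le_one_of_one_le₀ ?_
      push_cast
      linarith [(Nat.cast_nonneg n : (0 : ℝ) ≤ n)]
    calc (r ^ (n + 1) * ((2 + n : ℕ) : ℝ))⁻¹ * (b j * ‖z‖) ^ (2 + n)
        = (b j * ‖z‖) ^ 2 / r * ((b j * ‖z‖ / r) ^ n * ((2 + n : ℕ) : ℝ)⁻¹) := by
          rw [div_pow, pow_succ, pow_add, mul_inv, mul_inv]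
          ring
      _ ≤ (b j * ‖z‖) ^ 2 / r * ((1 / 2) ^ n * 1) := by gcongr
      _ = _ := by
          rw [pow_add]
          ring

theorem summable_pow_of_sq {b : ℕ → ℝ} {B : ℝ} (hb0 : ∀ j, 0 ≤ b j) (hbB : ∀ j, b j ≤ B)
    (hb2 : Summable fun j => b j ^ 2) {m : ℕ} (hm : 2 ≤ m) : Summable fun j => b j ^ m := by
  obtain ⟨n, rfl⟩ := Nat.exists_eq_add_of_le hm
  refine Summable.of_nonneg_of_le (fun j => pow_nonneg (hb0 j) _) (fun j => ?_)
    (hb2.mul_right (B ^ n))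
  rw [pow_add]
  exact mul_le_mul_of_nonneg_left (pow_le_pow_left₀ (hb0 j) (hbB j) n) (sq_nonneg _)

/-- The exponent of the series as a power series. -/
theorem exists_hasSum_seriesCoeff (hr : 0 < r) (hb0 : ∀ j, 0 ≤ b j)
    (hbB : ∀ j, b j ≤ B) (hb2 : Summable fun j => b j ^ 2) {z : ℂ} (hz : ‖z‖ * B ≤ r / 2) :
    ∃ s, HasSum (fun j => gammaExponent r (b j * z)) s ∧
      HasSum (fun m => (seriesCoeff r b m : ℂ) * z ^ m) s := by
  set F : ℕ × ℕ → ℂ := fun p => (gammaCoeff r p.2 : ℂ) * (b p.1 * z) ^ p.2 with hF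
  have hsum : Summable F := by
    have h0 : 0 ≤ 4 * ‖z‖ ^ 2 / r := by positivity
    have h1 := (hb2.mul_left (4 * ‖z‖ ^ 2 / r)).mul_of_nonneg summable_geometric_two
      (fun j => mul_nonneg h0 (sq_nonneg _)) fun m => by positivity
    exact h1.of_norm_bounded fun p => norm_gammaCoeff_mul_le hr hb0 hbB hz p.1 p.2
  refine ⟨∑' p, F p, hsum.hasSum.prod_fiberwise (g := fun j => gammaExponent r (b j * z))
    fun j => ?_, ?_⟩
  · have hj : ‖(b j : ℂ) * z‖ < r := by
      rw [norm_mul, Complex.norm_real, Real.norm_of_nonneg (hb0 j), mul_comm]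
      have := mul_le_mul_of_nonneg_left (hbB j) (norm_nonneg z)
      linarith
    have := hasSum_gammaExponent hr hj
    simpa only [hF] using this
  · have hswap : HasSum (fun p : ℕ × ℕ => F p.swap) (∑' p, F p) :=
      (Equiv.prodComm ℕ ℕ).hasSum_iff.mpr hsum.hasSum
    refine hswap.prod_fiberwise (g := fun m => (seriesCoeff r b m : ℂ) * z ^ m) fun m => ?_
    simp only [hF, Prod.swap_prod_mk]
    by_cases hm : m < 2
    · simp [seriesCoeff, gammaCoeff, hm, hasSum_zero]
    · have hbm := summable_pow_of_sq hb0 hbB hb2 (not_lt.mp hm)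
      have h1 : HasSum (fun j => ((b j ^ m : ℝ) : ℂ)) ((∑' j, b j ^ m : ℝ) : ℂ) :=
        Complex.hasSum_ofReal.mpr hbm.hasSum
      have h2 := (h1.mul_left (gammaCoeff r m : ℂ)).mul_right (z ^ m)
      rw [← Complex.ofReal_mul] at h2
      refine h2.congr_fun fun j => ?_
      push_cast
      rw [mul_pow]
      ring

theorem charFun_limit_eq (hr : 0 < r) (hξ : ∀ j, IsCenteredGamma r (ξ j) P)
    (hind : iIndepFun ξ P) (hb0 : ∀ j, 0 ≤ b j) (hbB : ∀ j, b j ≤ B)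
    (hb2 : Summable fun j => b j ^ 2) {Y : Ω → ℝ}
    (hY : ∀ᵐ ω ∂P, Tendsto (fun K => ∑ j ∈ Finset.range K, b j * ξ j ω) atTop (𝓝 (Y ω)))
    {t : ℝ} (ht : |t| * B ≤ r / 2) :
    ∃ s, HasSum (fun m => (seriesCoeff r b m : ℂ) * (t * I) ^ m) s ∧
      charFun (P.map Y) t = cexp s := by
  obtain ⟨s, hs1, hs2⟩ := exists_hasSum_seriesCoeff (b := b) (z := t * I) hr hb0 hbB hb2
    (by simpa using ht)
  refine ⟨s, hs2, ?_⟩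
  refine tendsto_nhds_unique (tendsto_charFun_limit hr hξ hind hY t) ?_
  simp_rw [← Complex.exp_sum]
  exact (Complex.continuous_exp.tendsto _).comp hs1.tendsto_sum_nat

theorem zero_mem_interior_integrableExpSet (hr : 0 < r)
    (hξ : ∀ j, IsCenteredGamma r (ξ j) P)
    (hind : iIndepFun ξ P) (hb0 : ∀ j, 0 ≤ b j) (hbB : ∀ j, b j ≤ B)
    (hb2 : Summable fun j => b j ^ 2) {Y : Ω → ℝ}
    (hY : ∀ᵐ ω ∂P, Tendsto (fun K => ∑ j ∈ Finset.range K, b j * ξ j ω) atTop (𝓝 (Y ω))) :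
    0 ∈ interior (integrableExpSet Y P) := by
  rw [mem_interior_iff_mem_nhds]
  have h : ∀ᶠ t : ℝ in 𝓝 0, |t| * B < r / 2 :=
    (show Continuous fun t : ℝ => |t| * B by fun_prop).tendsto' 0 0 (by simp) |>.eventually_lt_const
      (by positivity)
  filter_upwards [h] with t ht
  exact integrable_exp_limit hr hξ hind hb0 hbB hb2 hY ht.le

/-- The exponent is known on the imaginary axis, from the characteristic function, whereas cumulants
live on the real axis. Analyticity of the complex moment generating function at `0` carries the
identity from one to the other. On the real axis the series is real, so the real logarithm undoes
the exponential. -/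
theorem eventually_hasSum_cgf (hr : 0 < r) (hξ : ∀ j, IsCenteredGamma r (ξ j) P)
    (hind : iIndepFun ξ P) (hb0 : ∀ j, 0 ≤ b j) (hbB : ∀ j, b j ≤ B)
    (hb2 : Summable fun j => b j ^ 2) {Y : Ω → ℝ}
    (hY : ∀ᵐ ω ∂P, Tendsto (fun K => ∑ j ∈ Finset.range K, b j * ξ j ω) atTop (𝓝 (Y ω))) :
    ∀ᶠ t in 𝓝 0, HasSum (fun m => seriesCoeff r b m * t ^ m) (cgf Y P t) := by
  have hYm := aemeasurable_limit hξ hY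
  set S : ℂ → ℂ := fun z => ∑' m, (seriesCoeff r b m : ℂ) * z ^ m with hS
  have hev : ∀ᶠ z : ℂ in 𝓝 0, ‖z‖ * B < r / 2 :=
    (show Continuous fun z : ℂ => ‖z‖ * B by fun_prop).tendsto' 0 0 (by simp)
      |>.eventually_lt_const (by positivity)
  have hSsum : ∀ z : ℂ, ‖z‖ * B < r / 2 →
      HasSum (fun m => (seriesCoeff r b m : ℂ) * z ^ m) (S z) := by
    intro z hz
    obtain ⟨s, -, hs⟩ := exists_hasSum_seriesCoeff (b := b) hr hb0 hbB hb2 hz.le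
    exact hs.summable.hasSum
  have hSan : AnalyticAt ℂ S 0 := by
    refine ⟨FormalMultilinearSeries.ofScalars ℂ fun m => (seriesCoeff r b m : ℂ),
      hasFPowerSeriesAt_iff.mpr ?_⟩
    filter_upwards [hev] with z hz
    simp only [FormalMultilinearSeries.coeff_ofScalars, zero_add, smul_eq_mul]
    exact (hSsum z hz).congr_fun fun m => mul_comm _ _
  have hMan : AnalyticAt ℂ (complexMGF Y P) 0 := analyticAt_complexMGF (by
    simpa using zero_mem_interior_integrableExpSet hr hξ hind hb0 hbB hb2 hY)
  have heq : ∀ᶠ z in 𝓝 0, complexMGF Y P z = cexp (S z) := by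
    -- By the isolated zeros principle, agreement at the points `i / (n + 1)` for large `n` is
    -- enough.
    refine (hMan.frequently_eq_iff_eventually_eq hSan.cexp).mp ?_
    have ht : Tendsto (fun n : ℕ => (((1 / ((n : ℝ) + 1)) : ℝ) : ℂ) * I) atTop (𝓝[≠] 0) := by
      refine tendsto_nhdsWithin_iff.mpr ⟨?_, Eventually.of_forall fun n => ?_⟩
      · have := ((Complex.continuous_ofReal.tendsto 0).comp
          (tendsto_one_div_add_atTop_nhds_zero_nat (𝕜 := ℝ))).mul_const I
        simpa only [Function.comp_def, ofReal_zero, zero_mul] using this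
      · have : 1 / ((n : ℝ) + 1) ≠ 0 := by positivity
        exact mul_ne_zero (Complex.ofReal_ne_zero.mpr this) I_ne_zero
    refine ht.frequently (Eventually.frequently ?_)
    filter_upwards [(ht.mono_right nhdsWithin_le_nhds).eventually hev] with n hn
    rw [complexMGF_mul_I hYm]
    obtain ⟨s, hs1, hs2⟩ := charFun_limit_eq hr hξ hind hb0 hbB hb2 hY
      (t := 1 / ((n : ℝ) + 1)) (by
        rw [norm_mul, Complex.norm_real, Complex.norm_I, mul_one] at hn
        exact hn.le)
    rw [hs2, hs1.unique (hSsum _ hn), Function.comp_apply]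
  have hre : Tendsto (fun t : ℝ => (t : ℂ)) (𝓝 0) (𝓝 0) := by
    simpa using Complex.continuous_ofReal.tendsto 0
  filter_upwards [hre.eventually heq, hre.eventually hev] with t h1 h2
  have h3 := hSsum _ h2
  have h4 : HasSum (fun m => ((seriesCoeff r b m * t ^ m : ℝ) : ℂ)) (S t) := by
    push_cast
    exact h3
  have h5 : S t = ((∑' m, seriesCoeff r b m * t ^ m : ℝ) : ℂ) := by
    rw [Complex.ofReal_tsum]
    exact h4.tsum_eq.symm
  rw [h5] at h4 h1
  have h6 := Complex.hasSum_ofReal.mp h4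
  rw [complexMGF_ofReal, ← Complex.ofReal_exp, Complex.ofReal_inj] at h1
  rw [cgf, h1, Real.log_exp]
  exact h6

/-- The cumulants of the series. -/
theorem iteratedDeriv_cgf_limit (hr : 0 < r) (hξ : ∀ j, IsCenteredGamma r (ξ j) P)
    (hind : iIndepFun ξ P) (hb0 : ∀ j, 0 ≤ b j) (hbB : ∀ j, b j ≤ B)
    (hb2 : Summable fun j => b j ^ 2) {Y : Ω → ℝ}
    (hY : ∀ᵐ ω ∂P, Tendsto (fun K => ∑ j ∈ Finset.range K, b j * ξ j ω) atTop (𝓝 (Y ω)))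
    (k : ℕ) : iteratedDeriv k (cgf Y P) 0 = k.factorial * seriesCoeff r b k := by
  have h1 : HasFPowerSeriesAt (cgf Y P)
      (FormalMultilinearSeries.ofScalars ℝ (seriesCoeff r b)) 0 := by
    refine hasFPowerSeriesAt_iff.mpr ?_
    filter_upwards [eventually_hasSum_cgf hr hξ hind hb0 hbB hb2 hY] with t ht
    simp only [FormalMultilinearSeries.coeff_ofScalars, zero_add, smul_eq_mul]
    exact ht.congr_fun fun m => mul_comm _ _
  have h2 := h1.analyticAt.hasFPowerSeriesAt.eq_formalMultilinearSeries h1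
  have h3 := congrFun (FormalMultilinearSeries.ofScalars_series_injective ℝ ℝ h2) k
  rw [← h3]
  have : (k.factorial : ℝ) ≠ 0 := by positivity
  field_simp

theorem variance_limit (hr : 0 < r) (hξ : ∀ j, IsCenteredGamma r (ξ j) P)
    (hind : iIndepFun ξ P) (hb0 : ∀ j, 0 ≤ b j) (hbB : ∀ j, b j ≤ B)
    (hb2 : Summable fun j => b j ^ 2) {Y : Ω → ℝ}
    (hY : ∀ᵐ ω ∂P, Tendsto (fun K => ∑ j ∈ Finset.range K, b j * ξ j ω) atTop (𝓝 (Y ω))) :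
    variance Y P = 1 / r * ∑' j, b j ^ 2 := by
  have h0 := zero_mem_interior_integrableExpSet hr hξ hind hb0 hbB hb2 hY
  have h1 := iteratedDeriv_cgf_limit hr hξ hind hb0 hbB hb2 hY 2
  rw [iteratedDeriv_two_cgf_eq_integral h0, deriv_cgf_zero h0] at h1
  rw [variance_eq_integral (aemeasurable_limit hξ hY)]
  simp only [zero_mul, Real.exp_zero, mul_one, mgf_zero, div_one, probReal_univ] at h1
  rw [h1, seriesCoeff, gammaCoeff]
  norm_num
  ring

/-- All factors have modulus at most one, so only the first `M` are retained, and each of these is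
at most its value at the smallest weight `β`. -/
theorem norm_charFun_limit_le (hr : 0 < r) (hξ : ∀ j, IsCenteredGamma r (ξ j) P)
    (hind : iIndepFun ξ P) {Y : Ω → ℝ}
    (hY : ∀ᵐ ω ∂P, Tendsto (fun K => ∑ j ∈ Finset.range K, b j * ξ j ω) atTop (𝓝 (Y ω)))
    {M : ℕ} {β : ℝ} (hβ : 0 ≤ β) (hβb : ∀ j < M, β ≤ b j) (t : ℝ) :
    ‖charFun (P.map Y) t‖ ≤ ((1 + (β * t) ^ 2 / r ^ 2) ^ (-(r / 2))) ^ M := by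
  refine le_of_tendsto (tendsto_charFun_limit hr hξ hind hY t).norm ?_
  filter_upwards [eventually_ge_atTop M] with K hK
  have e : ∀ j, ‖cexp (gammaExponent r (b j * (t * I)))‖ =
      (1 + (b j * t) ^ 2 / r ^ 2) ^ (-(r / 2)) := by
    intro j
    rw [← norm_exp_gammaExponent_mul_I hr]
    push_cast
    ring_nf
  rw [norm_prod]
  simp_rw [e]
  have hle : ∀ j, (1 + (b j * t) ^ 2 / r ^ 2) ^ (-(r / 2)) ≤ 1 := fun j =>
    Real.rpow_le_one_of_one_le_of_nonpos (by
      have : 0 ≤ (b j * t) ^ 2 / r ^ 2 := by positivity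
      linarith) (by linarith)
  calc _ ≤ ∏ j ∈ Finset.range M, (1 + (b j * t) ^ 2 / r ^ 2) ^ (-(r / 2)) := by
        rw [← Finset.prod_range_mul_prod_Ico _ hK]
        exact mul_le_of_le_one_right (Finset.prod_nonneg fun j _ => by positivity)
          (Finset.prod_le_one (fun j _ => by positivity) fun j _ => hle j)
    _ ≤ ∏ j ∈ Finset.range M, (1 + (β * t) ^ 2 / r ^ 2) ^ (-(r / 2)) := by
        refine Finset.prod_le_prod (fun j _ => by positivity) fun j hj => ?_
        refine Real.rpow_le_rpow_of_nonpos (by positivity) ?_ (by linarith)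
        have := hβb j (Finset.mem_range.mp hj)
        rw [mul_pow, mul_pow]
        gcongr
    _ = _ := by rw [Finset.prod_const, Finset.card_range]

end Series

end GammaTail

namespace GammaTail

/-! ### Monotone regularly varying sequences -/

section RegularVariation

variable {γ : ℝ} {ℓ : ℝ → ℝ} {lam : ℕ → ℝ}

theorem tendsto_ratio_two_mul (hℓ : SlowlyVarying ℓ)
    (hlam : ∀ n : ℕ, 1 ≤ n → lam n = ℓ n * (n : ℝ) ^ (-γ)) :
    Tendsto (fun n : ℕ => lam (2 * n) / lam n) atTop (𝓝 (2 ^ (-γ))) := by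
  have h1 := ((hℓ.2 2 two_pos).comp tendsto_natCast_atTop_atTop).mul_const ((2 : ℝ) ^ (-γ))
  rw [one_mul] at h1
  refine h1.congr' ?_
  filter_upwards [eventually_ge_atTop 1] with n hn
  have hn' : (0 : ℝ) < n := by exact_mod_cast hn
  rw [hlam n hn, hlam (2 * n) (by omega), Nat.cast_mul, Nat.cast_ofNat, Function.comp_apply,
    Real.mul_rpow (by norm_num) hn'.le]
  have : (n : ℝ) ^ (-γ) ≠ 0 := (Real.rpow_pos_of_pos hn' _).ne'
  rw [← mul_assoc, mul_div_mul_right _ _ this]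
  ring

theorem exists_doubling_bounds (hγ : 1 / 2 < γ) (hℓ : SlowlyVarying ℓ)
    (hlam : ∀ n : ℕ, 1 ≤ n → lam n = ℓ n * (n : ℝ) ^ (-γ)) (hpos : ∀ n : ℕ, 1 ≤ n → 0 < lam n) :
    ∃ q c : ℝ, 0 < q ∧ 2 * q ^ 2 < 1 ∧ 0 < c ∧ ∃ M₀ : ℕ, 1 ≤ M₀ ∧ ∀ n, M₀ ≤ n →
      c * lam n ≤ lam (2 * n) ∧ lam (2 * n) ≤ q * lam n := by
  set p : ℝ := 2 ^ (-γ) with hp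
  set h : ℝ := 2 ^ (-(1 / 2) : ℝ) with hh
  have hp0 : 0 < p := by positivity
  have hph : p < h := Real.rpow_lt_rpow_of_exponent_lt (by norm_num) (by linarith)
  have hh2 : h ^ 2 = 1 / 2 := by
    rw [hh, ← Real.rpow_natCast, ← Real.rpow_mul (by norm_num)]
    norm_num
  -- The doubling ratio tends to `p = 2 ^ (-γ)`, which lies below `h = 2 ^ (-1/2)` because `γ >
  -- 1/2`. Any `q` strictly between them satisfies `2 q ^ 2 < 1`; the midpoint is taken.
  refine ⟨(p + h) / 2, p / 2, by linarith, ?_, by linarith, ?_⟩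
  · have : (p + h) / 2 < h := by linarith
    have h0 : 0 < (p + h) / 2 := by linarith
    nlinarith
  · have ht := tendsto_ratio_two_mul hℓ hlam
    have e1 := ht.eventually_lt_const (show p < (p + h) / 2 by linarith)
    have e2 := ht.eventually_const_lt (show p / 2 < p by linarith)
    obtain ⟨M₁, hM₁⟩ := (e1.and e2).exists_forall_of_atTop
    refine ⟨max M₁ 1, le_max_right _ _, fun n hn => ?_⟩
    have hn1 : 0 < lam n := hpos n ((le_max_right _ _).trans hn)
    obtain ⟨h1, h2⟩ := hM₁ n ((le_max_left _ _).trans hn)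
    rw [div_lt_iff₀ hn1] at h1
    rw [lt_div_iff₀ hn1] at h2
    exact ⟨h2.le, h1.le⟩

/-- Pair the indices `2 n` and `2 n + 1`: by monotonicity both terms are at most `q * lam n`. -/
theorem sum_Ico_two_mul_le {q : ℝ} {M : ℕ} (hM : 1 ≤ M) (hpos : ∀ n : ℕ, 1 ≤ n → 0 < lam n)
    (hanti : AntitoneOn lam (Set.Ici 1)) (hq : ∀ n, M ≤ n → lam (2 * n) ≤ q * lam n) {K : ℕ}
    (hK : M ≤ K) :
    ∑ n ∈ Finset.Ico (2 * M) (2 * K), lam n ^ 2 ≤ 2 * q ^ 2 * ∑ n ∈ Finset.Ico M K, lam n ^ 2 := by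
  induction K, hK using Nat.le_induction with
  | base => simp
  | succ K hK ih =>
    rw [show 2 * (K + 1) = 2 * K + 1 + 1 by ring, Finset.sum_Ico_succ_top (by omega),
      Finset.sum_Ico_succ_top (by omega), Finset.sum_Ico_succ_top hK]
    have h1 := hq K hK
    have h2 : lam (2 * K + 1) ≤ lam (2 * K) :=
      hanti (Set.mem_Ici.mpr (by omega)) (Set.mem_Ici.mpr (by omega)) (by omega)
    have h3 := hpos (2 * K) (by omega)
    have h4 := hpos (2 * K + 1) (by omega)
    have h5 : lam (2 * K) ^ 2 ≤ (q * lam K) ^ 2 := pow_le_pow_left₀ h3.le h1 2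
    have h6 : lam (2 * K + 1) ^ 2 ≤ lam (2 * K) ^ 2 := pow_le_pow_left₀ h4.le h2 2
    rw [mul_pow] at h5
    linarith

/-- The finite sum `S` over `[M, 2 K)` satisfies `S ≤ M * lam M ^ 2 + 2 q ^ 2 S`, by splitting at `2
M`. Solving for `S` bounds all partial sums, and hence also yields summability. -/
theorem sum_range_sq_le {q : ℝ} {M : ℕ} (hM : 1 ≤ M) (hpos : ∀ n : ℕ, 1 ≤ n → 0 < lam n)
    (hanti : AntitoneOn lam (Set.Ici 1)) (hq : ∀ n, M ≤ n → lam (2 * n) ≤ q * lam n)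
    (hq1 : 2 * q ^ 2 < 1) (n : ℕ) :
    ∑ j ∈ Finset.range n, lam (M + j) ^ 2 ≤ M * lam M ^ 2 / (1 - 2 * q ^ 2) := by
  set K := M + n with hK
  have hMK : M ≤ K := Nat.le_add_right _ _
  have h1 : ∑ j ∈ Finset.range n, lam (M + j) ^ 2 ≤ ∑ n ∈ Finset.Ico M (2 * K), lam n ^ 2 := by
    have : ∑ j ∈ Finset.range n, lam (M + j) ^ 2 = ∑ n ∈ Finset.Ico M K, lam n ^ 2 := by
      rw [Finset.sum_Ico_eq_sum_range, hK, Nat.add_sub_cancel_left]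
    rw [this]
    exact Finset.sum_le_sum_of_subset_of_nonneg (Finset.Ico_subset_Ico_right (by omega))
      fun n _ _ => sq_nonneg _
  have h2 : ∑ n ∈ Finset.Ico M K, lam n ^ 2 ≤ ∑ n ∈ Finset.Ico M (2 * K), lam n ^ 2 :=
    Finset.sum_le_sum_of_subset_of_nonneg (Finset.Ico_subset_Ico_right (by omega))
      fun n _ _ => sq_nonneg _
  have h3 := sum_Ico_two_mul_le hM hpos hanti hq hMK
  have h4 : ∑ n ∈ Finset.Ico M (2 * M), lam n ^ 2 ≤ M * lam M ^ 2 := by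
    calc _ ≤ ∑ n ∈ Finset.Ico M (2 * M), lam M ^ 2 := by
          refine Finset.sum_le_sum fun n hn => ?_
          rw [Finset.mem_Ico] at hn
          exact pow_le_pow_left₀ (hpos n (by omega)).le
            (hanti (Set.mem_Ici.mpr hM) (Set.mem_Ici.mpr (by omega)) hn.1) 2
      _ = _ := by
          rw [Finset.sum_const, Nat.card_Ico, nsmul_eq_mul]
          congr 2
          omega
  have h5 := Finset.sum_Ico_consecutive (fun n => lam n ^ 2) (show M ≤ 2 * M by omega)
    (show 2 * M ≤ 2 * K by omega)
  rw [le_div_iff₀ (by linarith)]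
  have h6 : (1 - 2 * q ^ 2) * ∑ n ∈ Finset.Ico M (2 * K), lam n ^ 2 ≤ M * lam M ^ 2 := by
    nlinarith [sq_nonneg q]
  nlinarith

/-- The tail sums of squares of a monotone regularly varying sequence of index below `-1/2` are
comparable to `M * lam M ^ 2`. -/
theorem exists_tail_bounds (hγ : 1 / 2 < γ) (hℓ : SlowlyVarying ℓ)
    (hlam : ∀ n : ℕ, 1 ≤ n → lam n = ℓ n * (n : ℝ) ^ (-γ)) (hpos : ∀ n : ℕ, 1 ≤ n → 0 < lam n)
    (hanti : AntitoneOn lam (Set.Ici 1)) :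
    (∀ M : ℕ, Summable fun j => lam (M + j) ^ 2) ∧
    ∃ c C : ℝ, 0 < c ∧ 0 < C ∧ ∀ᶠ M : ℕ in atTop,
      c ^ 2 * (M * lam M ^ 2) ≤ ∑' j, lam (M + j) ^ 2 ∧
      ∑' j, lam (M + j) ^ 2 ≤ C * (M * lam M ^ 2) ∧
      ∀ j < M, c * lam M ≤ lam (M + j) := by
  obtain ⟨q, c, hq, hq1, hc, M₀, hM₀, hd⟩ := exists_doubling_bounds hγ hℓ hlam hpos
  have hsum : ∀ M, M₀ ≤ M → Summable fun j => lam (M + j) ^ 2 := fun M hM =>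
    summable_of_sum_range_le (fun j => sq_nonneg _)
      (sum_range_sq_le (hM₀.trans hM) hpos hanti (fun n hn => (hd n (hM.trans hn)).2) hq1)
  have hsum0 : Summable fun n => lam n ^ 2 := by
    have := hsum M₀ le_rfl
    simp_rw [add_comm M₀] at this
    exact (summable_nat_add_iff M₀).mp this
  refine ⟨fun M => ?_, c, (1 - 2 * q ^ 2)⁻¹, hc, inv_pos.mpr (by linarith), ?_⟩
  · have := (summable_nat_add_iff M).mpr hsum0
    simp_rw [add_comm _ M] at this
    exact this
  filter_upwards [eventually_ge_atTop M₀] with M hM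
  have hM1 : 1 ≤ M := hM₀.trans hM
  have hlow : ∀ j < M, c * lam M ≤ lam (M + j) := fun j hj => (hd M hM).1.trans
    (hanti (Set.mem_Ici.mpr (by omega)) (Set.mem_Ici.mpr (by omega)) (by omega))
  refine ⟨?_, ?_, hlow⟩
  · calc c ^ 2 * (M * lam M ^ 2) = ∑ j ∈ Finset.range M, (c * lam M) ^ 2 := by
          rw [Finset.sum_const, Finset.card_range, nsmul_eq_mul]
          ring
      _ ≤ ∑ j ∈ Finset.range M, lam (M + j) ^ 2 := by
          refine Finset.sum_le_sum fun j hj => ?_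
          exact pow_le_pow_left₀ (mul_nonneg hc.le (hpos M hM1).le) (hlow j (Finset.mem_range.mp hj)) 2
      _ ≤ _ := (hsum M hM).sum_le_tsum _ fun j _ => sq_nonneg _
  · rw [inv_mul_eq_div]
    exact Real.tsum_le_of_sum_range_le (fun j => sq_nonneg _)
      (sum_range_sq_le hM1 hpos hanti (fun n hn => (hd n (hM.trans hn)).2) hq1)

end RegularVariation

/-- Bernoulli's inequality in the form needed for the decay of the characteristic function. -/
theorem rpow_neg_pow_le {r y : ℝ} (hr : 0 < r) (hy : 0 ≤ y) {N M : ℕ} (hM : 0 < M)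
    (hNM : 2 * (N + 1) / r ≤ (M : ℝ)) :
    ((1 + y / M) ^ (-(r / 2))) ^ M ≤ ((1 + y / (2 * (N + 1) / r)) ^ (N + 1))⁻¹ := by
  set L : ℝ := 2 * (N + 1) / r with hL
  have hL0 : 0 < L := by positivity
  have hM' : (0 : ℝ) < M := by exact_mod_cast hM
  -- `L` is the value for which `(1 + y/M) ^ (-r M/2)` equals `((1 + y/M) ^ (M/L)) ^ (-(N + 1))`.
  -- Bernoulli's inequality for the exponent `M / L ≥ 1` then removes `M` from the bound.
  have hb := one_add_mul_self_le_rpow_one_add (s := y / M)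
    (by have : 0 ≤ y / M := by positivity
        linarith) (p := M / L) (by rwa [one_le_div hL0])
  have e1 : (M / L : ℝ) * (y / M) = y / L := by field_simp
  rw [e1] at hb
  have h1 : 0 < 1 + y / M := by positivity
  have e2 : ((1 + y / M) ^ (-(r / 2))) ^ M = (((1 + y / M) ^ (M / L : ℝ)) ^ (N + 1))⁻¹ := by
    rw [← Real.rpow_natCast, ← Real.rpow_natCast, ← Real.rpow_mul h1.le, ← Real.rpow_mul h1.le,
      ← Real.rpow_neg h1.le]
    congr 1
    rw [hL]
    push_cast
    field_simp
  rw [e2]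
  gcongr

end GammaTail

namespace GammaTail

/-! ### Tails of the gamma series -/

section Tail

variable {Ω : Type*} {lam : ℕ → ℝ} {η : ℕ → Ω → ℝ}

theorem partialTail_add (M K : ℕ) (ω : Ω) : partialTail lam η M (M + K) ω =
    ∑ j ∈ Finset.range K, lam (M + j) * (η (M + j) ω - 1) := by
  rw [partialTail, Finset.sum_Ico_eq_sum_range, Nat.add_sub_cancel_left]

theorem tendsto_partialTail_iff (M : ℕ) (ω : Ω) (l : ℝ) :
    Tendsto (fun K => ∑ j ∈ Finset.range K, lam (M + j) * (η (M + j) ω - 1)) atTop (𝓝 l) ↔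
      Tendsto (fun K => partialTail lam η M K ω) atTop (𝓝 l) := by
  rw [← tendsto_add_atTop_iff_nat M (f := fun K => partialTail lam η M K ω)]
  simp_rw [add_comm _ M, partialTail_add]

variable [MeasurableSpace Ω] {P : Measure Ω} {r : ℝ}

theorem IsCenteredGamma.congr {X X' : Ω → ℝ} (hX : IsCenteredGamma r X P) (h : X =ᵐ[P] X') :
    IsCenteredGamma r X' P where
  aemeasurable := hX.aemeasurable.congr h
  integrable_exp t ht := (hX.integrable_exp t ht).congr (by
    filter_upwards [h] with ω hω
    rw [hω])
  complexMGF_eq z hz := by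
    rw [← hX.complexMGF_eq z hz, complexMGF, complexMGF]
    refine integral_congr_ae ?_
    filter_upwards [h] with ω hω
    rw [hω]

theorem iIndepFun_shift (hindep : iIndepFun (fun n : ℕ => η (n + 1)) P) {M : ℕ} (hM : 1 ≤ M) :
    iIndepFun (fun j ω => η (M + j) ω - 1) P := by
  have h1 := hindep.precomp (g := fun j => M - 1 + j) fun i j h => by
    simpa using h
  have e : (fun j => η (M - 1 + j + 1)) = fun j => η (M + j) := by
    ext j : 1
    congr 1
    omega
  rw [e] at h1
  exact h1.comp (fun _ x => x - 1) fun _ => by fun_prop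

variable [IsProbabilityMeasure P]

theorem ae_tendsto_partialTail (hr : 0 < r) (hpos : ∀ n : ℕ, 1 ≤ n → 0 < lam n)
    (hanti : AntitoneOn lam (Set.Ici 1)) (hsq : ∀ M : ℕ, Summable fun j => lam (M + j) ^ 2)
    (hlaw : ∀ n : ℕ, 1 ≤ n → HasLaw (η n) (gammaMeasure r r) P)
    (hindep : iIndepFun (fun n : ℕ => η (n + 1)) P) {M : ℕ} (hM : 1 ≤ M) :
    ∀ᵐ ω ∂P, Tendsto (fun K : ℕ => partialTail lam η M K ω) atTop (𝓝 (tail lam η M ω)) := by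
  have hξ : ∀ j, IsCenteredGamma r (fun ω => η (M + j) ω - 1) P := fun j =>
    isCenteredGamma_sub_one hr (hlaw _ (by omega))
  -- The natural filtration requires genuinely measurable variables, so measurable versions are used
  -- and the exceptional null sets discarded.
  have hae : ∀ j, (fun ω => η (M + j) ω - 1) =ᵐ[P] (hξ j).aemeasurable.mk _ := fun j =>
    (hξ j).aemeasurable.ae_eq_mk
  have h := ae_exists_tendsto_partialSum (b := fun j => lam (M + j)) hr (hpos M hM)
    (fun j => (hξ j).aemeasurable.measurable_mk) (fun j => (hξ j).congr (hae j))
    ((iIndepFun_shift hindep hM).congr hae) (fun j => (hpos _ (by omega)).le)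
    (fun j => hanti (Set.mem_Ici.mpr hM) (Set.mem_Ici.mpr (by omega)) (by omega)) (hsq M)
  filter_upwards [h, ae_all_iff.mpr hae] with ω ⟨l, hl⟩ hω
  simp_rw [← hω] at hl
  exact tendsto_nhds_limUnder ⟨l, (tendsto_partialTail_iff M ω l).mp hl⟩

theorem tailStd_sq (hr : 0 < r) (hpos : ∀ n : ℕ, 1 ≤ n → 0 < lam n)
    (hanti : AntitoneOn lam (Set.Ici 1)) (hsq : ∀ M : ℕ, Summable fun j => lam (M + j) ^ 2)
    (hlaw : ∀ n : ℕ, 1 ≤ n → HasLaw (η n) (gammaMeasure r r) P)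
    (hindep : iIndepFun (fun n : ℕ => η (n + 1)) P) {M : ℕ} (hM : 1 ≤ M) :
    tailStd P lam η M ^ 2 = 1 / r * ∑' j, lam (M + j) ^ 2 := by
  rw [tailStd, Real.sq_sqrt (variance_nonneg _ _)]
  refine variance_limit (B := lam M) (ξ := fun j ω => η (M + j) ω - 1) hr
    (fun j => isCenteredGamma_sub_one hr (hlaw _ (by omega)))
    (iIndepFun_shift hindep hM) (fun j => (hpos _ (by omega)).le)
    (fun j => hanti (Set.mem_Ici.mpr hM) (Set.mem_Ici.mpr (by omega)) (by omega)) (hsq M) ?_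
  filter_upwards [ae_tendsto_partialTail hr hpos hanti hsq hlaw hindep hM] with ω hω
  exact (tendsto_partialTail_iff M ω _).mpr hω

theorem tailStd_pos (hr : 0 < r) (hpos : ∀ n : ℕ, 1 ≤ n → 0 < lam n)
    (hanti : AntitoneOn lam (Set.Ici 1)) (hsq : ∀ M : ℕ, Summable fun j => lam (M + j) ^ 2)
    (hlaw : ∀ n : ℕ, 1 ≤ n → HasLaw (η n) (gammaMeasure r r) P)
    (hindep : iIndepFun (fun n : ℕ => η (n + 1)) P) {M : ℕ} (hM : 1 ≤ M) :
    0 < tailStd P lam η M := by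
  have h1 := tailStd_sq hr hpos hanti hsq hlaw hindep hM
  have h2 : 0 < ∑' j, lam (M + j) ^ 2 :=
    (hsq M).tsum_pos (fun j => sq_nonneg _) 0 (pow_pos (hpos _ (by omega)) 2)
  have h3 : 0 < tailStd P lam η M ^ 2 := by
    rw [h1]
    positivity
  have h4 : 0 ≤ tailStd P lam η M := Real.sqrt_nonneg _
  exact lt_of_le_of_ne h4 fun h => by
    rw [← h] at h3
    simp at h3

theorem ae_tendsto_normTail (hr : 0 < r) (hpos : ∀ n : ℕ, 1 ≤ n → 0 < lam n)
    (hanti : AntitoneOn lam (Set.Ici 1)) (hsq : ∀ M : ℕ, Summable fun j => lam (M + j) ^ 2)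
    (hlaw : ∀ n : ℕ, 1 ≤ n → HasLaw (η n) (gammaMeasure r r) P)
    (hindep : iIndepFun (fun n : ℕ => η (n + 1)) P) {M : ℕ} (hM : 1 ≤ M) :
    ∀ᵐ ω ∂P, Tendsto (fun K : ℕ => ∑ j ∈ Finset.range K,
      ((tailStd P lam η M)⁻¹ * lam (M + j)) * (η (M + j) ω - 1)) atTop
        (𝓝 (normTail P lam η M ω)) := by
  filter_upwards [ae_tendsto_partialTail hr hpos hanti hsq hlaw hindep hM] with ω hω
  have := ((tendsto_partialTail_iff M ω _).mpr hω).const_mul (tailStd P lam η M)⁻¹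
  simp_rw [Finset.mul_sum, ← mul_assoc] at this
  exact this

theorem cumulant_normTail (hr : 0 < r) (hpos : ∀ n : ℕ, 1 ≤ n → 0 < lam n)
    (hanti : AntitoneOn lam (Set.Ici 1)) (hsq : ∀ M : ℕ, Summable fun j => lam (M + j) ^ 2)
    (hlaw : ∀ n : ℕ, 1 ≤ n → HasLaw (η n) (gammaMeasure r r) P)
    (hindep : iIndepFun (fun n : ℕ => η (n + 1)) P) {M : ℕ} (hM : 1 ≤ M) (k : ℕ) :
    cumulant P (normTail P lam η M) k =
      k.factorial * seriesCoeff r (fun j => (tailStd P lam η M)⁻¹ * lam (M + j)) k := by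
  have hσ := tailStd_pos hr hpos hanti hsq hlaw hindep hM
  refine iteratedDeriv_cgf_limit (B := (tailStd P lam η M)⁻¹ * lam M)
    (ξ := fun j ω => η (M + j) ω - 1) hr
    (fun j => isCenteredGamma_sub_one hr (hlaw _ (by omega)))
    (iIndepFun_shift hindep hM) (fun j => mul_nonneg (inv_nonneg.mpr hσ.le) (hpos _ (by omega)).le)
    (fun j => mul_le_mul_of_nonneg_left
      (hanti (Set.mem_Ici.mpr hM) (Set.mem_Ici.mpr (by omega)) (by omega)) (inv_nonneg.mpr hσ.le))
    ?_ (ae_tendsto_normTail hr hpos hanti hsq hlaw hindep hM) k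
  simp_rw [mul_pow]
  exact (hsq M).mul_left _

theorem hasSum_cumulant (hr : 0 < r) (hpos : ∀ n : ℕ, 1 ≤ n → 0 < lam n)
    (hanti : AntitoneOn lam (Set.Ici 1)) (hsq : ∀ M : ℕ, Summable fun j => lam (M + j) ^ 2)
    (hlaw : ∀ n : ℕ, 1 ≤ n → HasLaw (η n) (gammaMeasure r r) P)
    (hindep : iIndepFun (fun n : ℕ => η (n + 1)) P) {M : ℕ} (hM : 1 ≤ M) {k : ℕ} (hk : 2 ≤ k) :
    HasSum (fun j : ℕ => ((k - 1).factorial : ℝ) /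
        (r ^ (k - 1) * tailStd P lam η M ^ k) * lam (M + j) ^ k)
      (cumulant P (normTail P lam η M) k) := by
  have hs := summable_pow_of_sq (b := fun j => lam (M + j)) (B := lam M)
    (fun j => (hpos _ (by omega)).le)
    (fun j => hanti (Set.mem_Ici.mpr hM) (Set.mem_Ici.mpr (by omega)) (by omega)) (hsq M) hk
  have h1 := hs.hasSum.mul_left (((k - 1).factorial : ℝ) / (r ^ (k - 1) * tailStd P lam η M ^ k))
  have hσ := tailStd_pos hr hpos hanti hsq hlaw hindep hM
  have e : cumulant P (normTail P lam η M) k = ((k - 1).factorial : ℝ) /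
      (r ^ (k - 1) * tailStd P lam η M ^ k) * ∑' j, lam (M + j) ^ k := by
    rw [cumulant_normTail hr hpos hanti hsq hlaw hindep hM, seriesCoeff, gammaCoeff,
      if_neg (by omega)]
    simp_rw [mul_pow]
    rw [tsum_mul_left, ← Nat.mul_factorial_pred (show k ≠ 0 by omega)]
    have hk' : (k : ℝ) ≠ 0 := by positivity
    push_cast
    rw [inv_pow]
    field_simp
  rw [e]
  exact h1

/-- The normalization `∑ b j ^ 2 = r` means unit variance, and `b j ^ m ≤ b j ^ 2 * B ^ (m - 2)`.
Hence `B / r` plays the role of the small parameter `θ`. -/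
theorem seriesCoeff_le (hr : 0 < r) {b : ℕ → ℝ} {B : ℝ} (hb0 : ∀ j, 0 ≤ b j)
    (hbB : ∀ j, b j ≤ B) (hb2 : HasSum (fun j => b j ^ 2) r) {m : ℕ} (hm : 3 ≤ m) :
    |seriesCoeff r b m| ≤ (B / r) ^ (m - 2) := by
  obtain ⟨n, rfl⟩ := Nat.exists_eq_add_of_le (show 2 ≤ m by omega)
  have hB : 0 ≤ B := (hb0 0).trans (hbB 0)
  have h1 : ∑' j, b j ^ (2 + n) ≤ r * B ^ n := by
    rw [← hb2.tsum_eq, ← tsum_mul_right]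
    refine (summable_pow_of_sq hb0 hbB hb2.summable (by omega)).tsum_le_tsum (fun j => ?_)
      (hb2.summable.mul_right _)
    rw [pow_add]
    exact mul_le_mul_of_nonneg_left (pow_le_pow_left₀ (hb0 j) (hbB j) n) (sq_nonneg _)
  have h0 : 0 ≤ ∑' j, b j ^ (2 + n) := tsum_nonneg fun j => pow_nonneg (hb0 j) _
  rw [seriesCoeff, abs_of_nonneg (mul_nonneg (gammaCoeff_nonneg hr _) h0), gammaCoeff,
    if_neg (by omega), show 2 + n - 1 = n + 1 by omega, Nat.add_sub_cancel_left]
  have h3 : (1 : ℝ) ≤ ((2 + n : ℕ) : ℝ) := by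
    push_cast
    linarith [(Nat.cast_nonneg n : (0 : ℝ) ≤ n)]
  calc (r ^ (n + 1) * ((2 + n : ℕ) : ℝ))⁻¹ * ∑' j, b j ^ (2 + n)
      ≤ (r ^ (n + 1) * 1)⁻¹ * (r * B ^ n) := by gcongr
    _ = (B / r) ^ n := by
      rw [mul_one, div_pow, pow_succ]
      field_simp

/-- Edgeworth expansion of a normalized series of centred gamma variables whose leading `M`
coefficients are of order `M ^ (-1/2)`. -/
theorem abs_measure_sub_edgeworth_le {r A β : ℝ} (hr : 0 < r) (hA : 0 < A) (hβ : 0 < β) {N : ℕ}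
    (hN : 2 ≤ N) {M : ℕ} (hM : 0 < M) (hNM : 2 * (N + 1) / r ≤ (M : ℝ))
    (hAM : A / Real.sqrt M / r ≤ 1) {ξ : ℕ → Ω → ℝ} {a : ℕ → ℝ}
    (hξ : ∀ j, IsCenteredGamma r (ξ j) P) (hind : iIndepFun ξ P) (ha0 : ∀ j, 0 ≤ a j)
    (haA : ∀ j, a j ≤ A / Real.sqrt M) (haβ : ∀ j < M, β / Real.sqrt M ≤ a j)
    (ha2 : HasSum (fun j => a j ^ 2) r) {Y : Ω → ℝ}
    (hY : ∀ᵐ ω ∂P, Tendsto (fun K => ∑ j ∈ Finset.range K, a j * ξ j ω) atTop (𝓝 (Y ω)))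
    {κ : ℕ → ℝ} (hκ : ∀ m, κ m = m.factorial * seriesCoeff r a m) (x : ℝ) :
    |P.real {ω | Y ω ≤ x} - edgeworth N κ x| ≤
      (Real.pi⁻¹ * ∫ t, edgeworthMajorant N ((β / r) ^ 2 / (2 * (N + 1) / r)) t) *
        (A / Real.sqrt M / r) ^ (N - 1) := by
  have hM' : (0 : ℝ) < M := by exact_mod_cast hM
  have hsM : 0 < Real.sqrt M := Real.sqrt_pos.mpr hM'
  have hYm := aemeasurable_limit hξ hY
  have : IsProbabilityMeasure (P.map Y) := Measure.isProbabilityMeasure_map hYm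
  have e : P.real {ω | Y ω ≤ x} = (P.map Y).real (Set.Iic x) := by
    rw [measureReal_def, measureReal_def, Measure.map_apply_of_aemeasurable hYm measurableSet_Iic]
    rfl
  rw [e]
  refine abs_measure_Iic_sub_edgeworth_le hN (by positivity) (c := seriesCoeff r a) (fun m _ => ?_)
    (by simp [seriesCoeff, gammaCoeff]) (by simp [seriesCoeff, gammaCoeff]) ?_ (by positivity) hAM
    (fun m hm => seriesCoeff_le hr ha0 haA ha2 hm) (fun t ht => ?_) (fun t => ?_) x
  · rw [hκ]
    field_simp
  · rw [seriesCoeff, ha2.tsum_eq, gammaCoeff, if_neg (by omega)]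
    norm_num
    field_simp
  · refine charFun_limit_eq hr hξ hind ha0 haA ha2.summable hY ?_
    -- The near region `θ |t| ≤ 1/16` lies well inside the disc `|t| * B ≤ r / 2` where the
    -- logarithm has its power series.
    have h1 : |t| * (A / Real.sqrt M) = r * (A / Real.sqrt M / r * |t|) := by
      field_simp
    rw [h1]
    nlinarith
  · refine (norm_charFun_limit_le hr hξ hind hY (by positivity) haβ t).trans ?_
    have e1 : (β / Real.sqrt M * t) ^ 2 / r ^ 2 = (β / r) ^ 2 * t ^ 2 / M := by
      rw [mul_pow, div_pow, Real.sq_sqrt hM'.le]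
      field_simp
    rw [e1]
    refine (rpow_neg_pow_le hr (by positivity) hM hNM).trans_eq ?_
    congr 3
    ring

theorem div_sqrt_pow_eq (A r : ℝ) {N M : ℕ} (hN : 2 ≤ N) (hM : 0 < M) :
    (A / Real.sqrt M / r) ^ (N - 1) = (A / r) ^ (N - 1) * (M : ℝ) ^ (-(((N : ℝ) - 1) / 2)) := by
  have hM' : (0 : ℝ) < M := by exact_mod_cast hM
  have h1 : A / Real.sqrt M / r = A / r * (M : ℝ) ^ (-(1 / 2) : ℝ) := by
    rw [Real.rpow_neg hM'.le, ← Real.sqrt_eq_rpow]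
    ring
  rw [h1, mul_pow, ← Real.rpow_natCast ((M : ℝ) ^ (-(1 / 2) : ℝ)), ← Real.rpow_mul hM'.le,
    Nat.cast_sub (by omega)]
  congr 2
  push_cast
  ring

theorem eventually_abs_sub_edgeworth_le (hr : 0 < r) (hpos : ∀ n : ℕ, 1 ≤ n → 0 < lam n)
    (hanti : AntitoneOn lam (Set.Ici 1)) (hsq : ∀ M : ℕ, Summable fun j => lam (M + j) ^ 2)
    {c C : ℝ} (hc : 0 < c) (hC : 0 < C) (hbounds : ∀ᶠ M : ℕ in atTop,
      c ^ 2 * (M * lam M ^ 2) ≤ ∑' j, lam (M + j) ^ 2 ∧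
      ∑' j, lam (M + j) ^ 2 ≤ C * (M * lam M ^ 2) ∧ ∀ j < M, c * lam M ≤ lam (M + j))
    (hlaw : ∀ n : ℕ, 1 ≤ n → HasLaw (η n) (gammaMeasure r r) P)
    (hindep : iIndepFun (fun n : ℕ => η (n + 1)) P) {N : ℕ} (hN : 2 ≤ N) :
    ∃ D : ℝ, ∀ᶠ M : ℕ in atTop, ∀ x : ℝ,
      |P.real {ω | normTail P lam η M ω ≤ x} -
          edgeworth N (cumulant P (normTail P lam η M)) x|
        ≤ D * (M : ℝ) ^ (-(((N : ℝ) - 1) / 2)) := by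
  -- Since `σ ^ 2` is `1 / r` times the tail sum, the lower tail bound gives `lam M / σ ≤ A / √M`,
  -- and the upper one gives `c * lam M / σ ≥ β / √M`.
  set A : ℝ := Real.sqrt r / c with hA
  set β : ℝ := c * Real.sqrt (r / C) with hβ
  have hA0 : 0 < A := by positivity
  have hβ0 : 0 < β := by positivity
  refine ⟨(Real.pi⁻¹ * ∫ t, edgeworthMajorant N ((β / r) ^ 2 / (2 * (N + 1) / r)) t) *
    (A / r) ^ (N - 1), ?_⟩
  -- This makes `θ ≤ 1`. The next condition provides enough factors for the characteristic function
  -- to decay to the order `N + 1`.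
  have hlarge : ∀ᶠ M : ℕ in atTop, A / r ≤ Real.sqrt M :=
    (Real.tendsto_sqrt_atTop.comp tendsto_natCast_atTop_atTop).eventually_ge_atTop _
  have hlarge2 : ∀ᶠ M : ℕ in atTop, 2 * (N + 1) / r ≤ (M : ℝ) :=
    tendsto_natCast_atTop_atTop.eventually_ge_atTop _
  filter_upwards [hbounds, hlarge, hlarge2, eventually_ge_atTop 1] with M ⟨hlow, hup, hj⟩ hM1 hM2 hM x
  have hM' : (0 : ℝ) < M := by exact_mod_cast hM
  have hsM : 0 < Real.sqrt M := Real.sqrt_pos.mpr hM'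
  have hsM2 : Real.sqrt M ^ 2 = M := Real.sq_sqrt hM'.le
  have hσ := tailStd_pos hr hpos hanti hsq hlaw hindep hM
  have hσ2 := tailStd_sq hr hpos hanti hsq hlaw hindep hM
  set σ := tailStd P lam η M with hσdef
  have hl := hpos M hM
  have ha2 : HasSum (fun j => (σ⁻¹ * lam (M + j)) ^ 2) r := by
    have h := (hsq M).hasSum.mul_left (σ⁻¹ ^ 2)
    have e : σ⁻¹ ^ 2 * ∑' j, lam (M + j) ^ 2 = r := by
      have : ∑' j, lam (M + j) ^ 2 = r * σ ^ 2 := by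
        rw [hσ2]
        field_simp
      rw [this]
      field_simp
    rw [e] at h
    simpa only [mul_pow] using h
  have hupper : σ⁻¹ * lam M ≤ A / Real.sqrt M := by
    rw [inv_mul_eq_div, div_le_div_iff₀ hσ hsM]
    refine (pow_le_pow_iff_left₀ (by positivity) (by positivity) two_ne_zero).mp ?_
    rw [mul_pow, mul_pow, hsM2, hA, div_pow, Real.sq_sqrt hr.le, hσ2]
    have : r / c ^ 2 * (1 / r * ∑' j, lam (M + j) ^ 2) = (∑' j, lam (M + j) ^ 2) / c ^ 2 := by
      field_simp
    rw [this, le_div_iff₀ (by positivity)]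
    linarith
  have hlower : β / Real.sqrt M ≤ σ⁻¹ * (c * lam M) := by
    rw [inv_mul_eq_div, div_le_div_iff₀ hsM hσ]
    refine (pow_le_pow_iff_left₀ (by positivity) (by positivity) two_ne_zero).mp ?_
    rw [hβ, mul_pow, mul_pow, mul_pow, mul_pow, hsM2, Real.sq_sqrt (by positivity), hσ2]
    have : c ^ 2 * (r / C) * (1 / r * ∑' j, lam (M + j) ^ 2) =
        c ^ 2 * ((∑' j, lam (M + j) ^ 2) / C) := by
      field_simp
    rw [this, mul_assoc]
    refine mul_le_mul_of_nonneg_left ?_ (by positivity)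
    rw [div_le_iff₀ hC]
    linarith
  have key := abs_measure_sub_edgeworth_le (P := P) (a := fun j => σ⁻¹ * lam (M + j))
    (ξ := fun j ω => η (M + j) ω - 1) hr hA0 hβ0 hN hM hM2
    (by
      rw [div_right_comm, div_le_one hsM]
      exact hM1)
    (fun j => isCenteredGamma_sub_one hr (hlaw _ (by omega))) (iIndepFun_shift hindep hM)
    (fun j => mul_nonneg (inv_nonneg.mpr hσ.le) (hpos _ (by omega)).le)
    (fun j => (mul_le_mul_of_nonneg_left (hanti (Set.mem_Ici.mpr hM) (Set.mem_Ici.mpr (by omega))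
      (by omega)) (inv_nonneg.mpr hσ.le)).trans hupper)
    (fun j hjM => hlower.trans (mul_le_mul_of_nonneg_left (hj j hjM) (inv_nonneg.mpr hσ.le)))
    ha2 (ae_tendsto_normTail hr hpos hanti hsq hlaw hindep hM)
    (cumulant_normTail hr hpos hanti hsq hlaw hindep hM) x
  rwa [div_sqrt_pow_eq A r hN hM, ← mul_assoc] at key

end Tail

end GammaTail

theorem theorem5p2 {Ω : Type*} [MeasurableSpace Ω] (P : Measure Ω) [IsProbabilityMeasure P]
    (r γ : ℝ) (hr : 0 < r) (hγ : 1 / 2 < γ)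
    (ℓ : ℝ → ℝ) (hℓ : GammaTail.SlowlyVarying ℓ)
    (lam : ℕ → ℝ) (hlam : ∀ n : ℕ, 1 ≤ n → lam n = ℓ n * (n : ℝ) ^ (-γ))
    (hpos : ∀ n : ℕ, 1 ≤ n → 0 < lam n) (hanti : AntitoneOn lam (Set.Ici 1))
    (η : ℕ → Ω → ℝ) (hlaw : ∀ n : ℕ, 1 ≤ n → HasLaw (η n) (gammaMeasure r r) P)
    (hindep : iIndepFun (fun n : ℕ => η (n + 1)) P) :
    -- the series defining the tail converges almost surely
    (∀ M : ℕ, 1 ≤ M → ∀ᵐ ω ∂P,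
      Tendsto (fun K : ℕ => GammaTail.partialTail lam η M K ω) atTop
        (𝓝 (GammaTail.tail lam η M ω))) ∧
    -- the variance of the tail
    (∀ M : ℕ, 1 ≤ M →
      HasSum (fun j : ℕ => 1 / r * lam (M + j) ^ 2) (GammaTail.tailStd P lam η M ^ 2)) ∧
    -- the cumulants of the normalized tail
    (∀ M : ℕ, 1 ≤ M → ∀ k : ℕ, 2 ≤ k →
      HasSum (fun j : ℕ => ((k - 1).factorial : ℝ) /
          (r ^ (k - 1) * GammaTail.tailStd P lam η M ^ k) * lam (M + j) ^ k)
        (GammaTail.cumulant P (GammaTail.normTail P lam η M) k)) ∧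
    -- the Edgeworth expansion, uniformly in `x`
    (∀ N : ℕ, 2 ≤ N → ∃ C : ℝ, ∀ᶠ M : ℕ in atTop, ∀ x : ℝ,
      |P.real {ω | GammaTail.normTail P lam η M ω ≤ x} -
          GammaTail.edgeworth N (GammaTail.cumulant P (GammaTail.normTail P lam η M)) x|
        ≤ C * (M : ℝ) ^ (-(((N : ℝ) - 1) / 2))) := by
  obtain ⟨hsq, c, C, hc, hC, hbounds⟩ := GammaTail.exists_tail_bounds hγ hℓ hlam hpos hanti
  refine ⟨fun M hM => GammaTail.ae_tendsto_partialTail hr hpos hanti hsq hlaw hindep hM,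
    fun M hM => ?_,
    fun M hM k hk => GammaTail.hasSum_cumulant hr hpos hanti hsq hlaw hindep hM hk,
    fun N hN => GammaTail.eventually_abs_sub_edgeworth_le hr hpos hanti hsq hc hC hbounds hlaw
      hindep hN⟩
  rw [GammaTail.tailStd_sq hr hpos hanti hsq hlaw hindep hM]
  exact (hsq M).hasSum.mul_left (1 / r)
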